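/- Let $d\ge 1$, let $G=(0,\infty)\times\mathbb{R}^d$, and let $d\lambda(a,b)=a^{-1}\,da\,db$. For $\phi\in L^2(\mathbb{R}^d)$ put $\phi_{a,b}(x)=a^{-d/2}\phi(a^{-1}x-b)$ and, for $f\in L^2(\mathbb{R}^d)$, $W_\phi f(a,b)=\langle f,\phi_{a,b}\rangle$. Let $\mathcal{A}_1$ be the set of all $\phi\in L^2(\mathbb{R}^d)$ such that (1) $\phi$ is admissible: $\int_0^\infty |\hat\phi(\xi x)|^2\,\frac{d\xi}{\xi}=1$ for a.e. $x\in\mathbb{R}^d$, where $\hat\phi(\eta)=\int\phi(x)e^{-2\pi i x\cdot\eta}\,dx$, extended to $L^2(\mathbb{R}^d)$; and (2) for some $0<\varepsilon<1$, $\int_G |W_\phi\phi(a,b)|\,a^{d/2+\varepsilon}\,d\lambda(a,b)<\infty$. A measurable function $\sigma:G\to[0,1]$ is called thin (with respect to $\phi$) if $$\tilde\sigma(y)=\int_G\sigma(x)\,|\langle\phi_x,\phi_y\rangle|^2\,d\lambda(x)\to 0$$ as $y\to\infty$ in $G$, that is, as $y$ leaves every compact subset of $G$. A measurable set $E\subset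 G$ is called thin if its indicator function is thin. **Theorem.** Let $\phi\in\mathcal{A}_1$. (a) If $\sigma:G\to[0,1]$ is thin, then the Toeplitz operator $T_{1-\sigma}f=\int_G(1-\sigma(x))\,\langle f,\phi_x\rangle\,\phi_x\,d\lambda(x)$ (weakly convergent integral) is a well-defined bounded operator on $L^2(\mathbb{R}^d)$, and there exists $c>0$ such that $$\langle T_{1-\sigma}f,f\rangle=\int_G(1-\sigma)\,|W_\phi f|^2\,d\lambda\ \ge\ c\,\|f\|^2\qquad\text{for all } f\in L^2(\mathbb{R}^d).$$ (b) If $E\subset G$ is thin, then there exists $c>0$ such that $$\int_{G\setminus E}|W_\phi f|^2\,d\lambda\ \ge\ c\,\|f\|^2\qquad\text{for all } f\in L^2(\mathbb{R}^d).$$ -/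

import Mathlib

noncomputable section

open MeasureTheory Filter Topology
open scoped FourierTransform ENNReal

namespace WaveletUncertainty

/-- `L²(ℝᵈ)` with complex values and Lebesgue measure. -/
abbrev L2 (d : ℕ) : Type :=
  Lp (α := EuclideanSpace ℝ (Fin d)) ℂ 2 (volume : Measure (EuclideanSpace ℝ (Fin d)))

/-- The underlying space `(0,∞) × ℝᵈ` of the wavelet (affine) group,
with the product topology and the product Borel structure. -/
abbrev AffineGp (d : ℕ) : Type := Set.Ioi (0 : ℝ) × EuclideanSpace ℝ (Fin d)

/-- The Haar measure `dλ(a,b) = a⁻¹ da db`. -/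
def haarAffine (d : ℕ) : Measure (AffineGp d) :=
  (((volume : Measure ℝ).comap ((↑) : Set.Ioi (0 : ℝ) → ℝ)).prod
    (volume : Measure (EuclideanSpace ℝ (Fin d)))).withDensity
      fun g => ENNReal.ofReal (g.1 : ℝ)⁻¹

/-- The function `x ↦ a^{-d/2} φ(a⁻¹ x - b)`. -/
def atomFun {d : ℕ} (φ : EuclideanSpace ℝ (Fin d) → ℂ) (g : AffineGp d)
    (x : EuclideanSpace ℝ (Fin d)) : ℂ :=
  (((g.1 : ℝ) ^ (-((d : ℝ) / 2)) : ℝ) : ℂ) * φ ((g.1 : ℝ)⁻¹ • x - g.2)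

theorem memLp_atomFun {d : ℕ} (φ : L2 d) (g : AffineGp d) :
    MemLp (atomFun (φ : EuclideanSpace ℝ (Fin d) → ℂ) g) 2 volume := by
  have ha : (g.1 : ℝ)⁻¹ ≠ 0 := inv_ne_zero (ne_of_gt g.1.2)
  have h1 : MemLp (fun x : EuclideanSpace ℝ (Fin d) => (φ : EuclideanSpace ℝ (Fin d) → ℂ) (x - g.2))
      2 volume :=
    (Lp.memLp φ).comp_measurePreserving (measurePreserving_sub_right volume g.2)
  have h2 : MemLp (fun x : EuclideanSpace ℝ (Fin d) => (φ : EuclideanSpace ℝ (Fin d) → ℂ) (x - g.2))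
      2 (Measure.map (fun x : EuclideanSpace ℝ (Fin d) => (g.1 : ℝ)⁻¹ • x) volume) := by
    rw [Measure.map_addHaar_smul volume ha]
    exact h1.smul_measure ENNReal.ofReal_ne_top
  exact (h2.comp_of_map (by fun_prop)).const_mul _

/-- The wavelet atom `φ_{a,b}(x) = a^{-d/2} φ(a⁻¹ x - b)` as an element of `L²(ℝᵈ)`. -/
def atom {d : ℕ} (φ : L2 d) (g : AffineGp d) : L2 d := (memLp_atomFun φ g).toLp _

/-- The wavelet transform `W_φ f(a,b) = ⟨f, φ_{a,b}⟩ = ∫ f(x) conj(φ_{a,b}(x)) dx`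
(Mathlib's inner product is conjugate-linear in its first entry). -/
def waveletTransform {d : ℕ} (φ f : L2 d) (g : AffineGp d) : ℂ := inner ℂ (atom φ g) f

/-- The admissible wavelets: `∫₀^∞ |φ̂(ξ x)|² ξ⁻¹ dξ = 1` for almost every `x`. -/
def Admissible {d : ℕ} (φ : L2 d) : Prop :=
  ∀ᵐ x : EuclideanSpace ℝ (Fin d),
    ∫⁻ ξ in Set.Ioi (0 : ℝ),
      ENNReal.ofReal (‖((𝓕 φ : L2 d) : EuclideanSpace ℝ (Fin d) → ℂ) (ξ • x)‖ ^ 2 / ξ) = 1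

/-- The weight `w_ε(a,b) = a^{d/2+ε}`. -/
def weight (d : ℕ) (ε : ℝ) (g : AffineGp d) : ℝ := (g.1 : ℝ) ^ ((d : ℝ) / 2 + ε)

/-- The class `B¹_w` of all `φ ∈ L²(ℝᵈ)` with `W_φ φ ∈ L¹(w dλ)`. -/
def classB {d : ℕ} (w : AffineGp d → ℝ) : Set (L2 d) :=
  {φ | Integrable (waveletTransform φ φ)
    ((haarAffine d).withDensity fun g => ENNReal.ofReal (w g))}

/-- The class `𝒜₁`: admissible wavelets that lie in `B¹_{w_ε}` for some `0 < ε < 1`. -/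
def classA1 (d : ℕ) : Set (L2 d) :=
  (⋃ ε ∈ Set.Ioo (0 : ℝ) 1, classB (weight d ε)) ∩ {φ | Admissible φ}

/-- The Berezin transform `σ̃(y) = ∫ σ(x) |⟨φ_x, φ_y⟩|² dλ(x)`. -/
def berezin {d : ℕ} (φ : L2 d) (σ : AffineGp d → ℝ) (y : AffineGp d) : ℝ :=
  ∫ x, σ x * ‖(inner ℂ (atom φ y) (atom φ x) : ℂ)‖ ^ 2 ∂(haarAffine d)

/-- A measurable symbol is thin if its Berezin transform vanishes at infinity. Here `y → ∞` means
that `y` leaves every compact set; for any metric which induces the topology of `(0,∞) × ℝᵈ` and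
whose balls are relatively compact, this is the same as `dist z y → ∞`. -/
def IsThin {d : ℕ} (φ : L2 d) (σ : AffineGp d → ℝ) : Prop :=
  Measurable σ ∧ Tendsto (berezin φ σ) (cocompact (AffineGp d)) (𝓝 0)

/-- A set is thin if its indicator function is. -/
def IsThinSet {d : ℕ} (φ : L2 d) (E : Set (AffineGp d)) : Prop :=
  IsThin φ (E.indicator fun _ => (1 : ℝ))

/-- `T` is the Toeplitz operator `T_σ f = ∫ σ(x) ⟨f, φ_x⟩ φ_x dλ(x)`. The vector-valued integral
is, as always for continuous frames, in the weak sense: `⟨T f, h⟩ = ∫ σ(x) ⟨f, φ_x⟩ ⟨φ_x, h⟩ dλ(x)`,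
absolutely convergent, for all `f, h`. This determines `T` uniquely. -/
def IsToeplitz {d : ℕ} (φ : L2 d) (σ : AffineGp d → ℝ) (T : L2 d →L[ℂ] L2 d) : Prop :=
  ∀ f h : L2 d,
    Integrable (fun x => (σ x : ℂ) * (inner ℂ (atom φ x) f * inner ℂ h (atom φ x)))
      (haarAffine d) ∧
    inner ℂ h (T f) =
      ∫ x, (σ x : ℂ) * (inner ℂ (atom φ x) f * inner ℂ h (atom φ x)) ∂(haarAffine d)

end WaveletUncertainty

end

noncomputable section

open MeasureTheory Filter Topology
open scoped FourierTransform ENNReal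

namespace WaveletUncertainty

/-! Admissibility makes `W_φ` an isometry into `L²(λ)` (`lintegral_waveletTransform_sq`), so failure
of the bound yields unit vectors `f_n` with `∫ (1 - σ) |W_φ f_n|² → 0`. Three facts exclude this.

Tails (`IsThin.hasSmallTails`). For each `δ` some compact `K` satisfies `∫_{Kᶜ} σ |W_φ f|² ≤ δ ‖f‖²`
for all `f`. This is a norm bound for the Toeplitz operator with symbol `s = 1_{Kᶜ} σ`, and it comes
from Schur's test with the weight `w(a,b) = a^{d/2+ε}` as test function. Since `w` is multiplicative
and `λ` is left invariant, the Schur integral at `x` equals `w(x) ∫ s(xz) |W_φ φ(z)| w(z) dλ(z)`.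
Away from a large compact set this is small because `W_φ φ` is integrable against `w`. On that set
Cauchy-Schwarz bounds it by a multiple of `σ̃(x)^{1/2}`, which is small for `x ∉ K`.

Uniqueness (`HasSmallTails.eq_zero`). Suppose `f ≠ 0` and `W_φ f` vanishes off a set `E` with small
tails. Translate `f` by `b, 2b, ..., Nb` with `b ≠ 0` tiny. The translates are linearly independent,
and the transform of every vector in their span lives on the union of the translated copies of `E`.
These copies capture little energy outside `E`, and the tails of `E` are small, so every unit vector
of an `N`-dimensional space has at least half of its energy in one fixed compact set `K`. Bessel's
inequality bounds `N` by `2 λ(K) ‖φ‖²`, and `N` was arbitrary.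

Compactness (`HasSmallTails.exists_lower_bound`). A weak limit `f₀` of the `f_n` has its transform
supported on `{σ = 1}`, so `f₀ = 0`. Then the energy of `f_n` in each compact set tends to zero. The
energy cannot escape through the tails, and the total energy 1 is lost. -/

/-! ### The affine group and its unitary representation -/

/-- The product `(a, b) (a', b') = (a a', a'⁻¹ b + b')` of the affine group. -/
def affMul {d : ℕ} (x y : AffineGp d) : AffineGp d :=
  (⟨(x.1 : ℝ) * y.1, Set.mem_Ioi.2 (mul_pos x.1.2 y.1.2)⟩, (y.1 : ℝ)⁻¹ • x.2 + y.2)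

/-- The inverse `(a, b)⁻¹ = (a⁻¹, - a b)` of the affine group. -/
def affInv {d : ℕ} (x : AffineGp d) : AffineGp d :=
  (⟨(x.1 : ℝ)⁻¹, Set.mem_Ioi.2 (inv_pos.2 x.1.2)⟩, -((x.1 : ℝ) • x.2))

/-- The pure translation `(1, b)`. -/
def affTrans {d : ℕ} (b : EuclideanSpace ℝ (Fin d)) : AffineGp d := (⟨1, Set.mem_Ioi.2 one_pos⟩, b)

theorem coe_fst_ne_zero {d : ℕ} (x : AffineGp d) : (x.1 : ℝ) ≠ 0 := ne_of_gt x.1.2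

theorem affMul_affInv_cancel_left {d : ℕ} (x y : AffineGp d) :
    affMul x (affMul (affInv x) y) = y := by
  have hx := coe_fst_ne_zero x
  have hy := coe_fst_ne_zero y
  ext1
  · ext1; simp [affMul, affInv, hx]
  · simp [affMul, affInv, smul_smul, hx]

theorem affInv_affMul_cancel_left {d : ℕ} (x y : AffineGp d) :
    affMul (affInv x) (affMul x y) = y := by
  have hx := coe_fst_ne_zero x
  have hy := coe_fst_ne_zero y
  ext1
  · ext1; simp [affMul, affInv, hx]
  · simp [affMul, affInv, smul_smul]
    field_simp
    simp

theorem continuous_affMul {d : ℕ} :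
    Continuous (fun p : AffineGp d × AffineGp d => affMul p.1 p.2) := by
  unfold affMul
  refine Continuous.prodMk (Continuous.subtype_mk (by fun_prop) _) ?_
  refine Continuous.add (Continuous.smul (Continuous.inv₀
    (continuous_subtype_val.comp (continuous_fst.comp continuous_snd)) ?_)
    (continuous_snd.comp continuous_fst)) (continuous_snd.comp continuous_snd)
  exact fun p => coe_fst_ne_zero p.2

theorem continuous_affInv {d : ℕ} : Continuous (affInv : AffineGp d → AffineGp d) := by
  unfold affInv
  refine Continuous.prodMk (Continuous.subtype_mk (Continuous.inv₀ (by fun_prop) ?_) _)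
    (by fun_prop)
  exact coe_fst_ne_zero

/-- Left translation as a homeomorphism of the affine group. -/
def affLeft {d : ℕ} (x : AffineGp d) : AffineGp d ≃ₜ AffineGp d where
  toFun := affMul x
  invFun := affMul (affInv x)
  left_inv := affInv_affMul_cancel_left x
  right_inv := affMul_affInv_cancel_left x
  continuous_toFun := continuous_affMul.comp (by fun_prop : Continuous fun y => (x, y))
  continuous_invFun := continuous_affMul.comp (by fun_prop : Continuous fun y => (affInv x, y))

/-- The map `x ↦ a⁻¹ x - b`. -/
def pullMap {d : ℕ} (g : AffineGp d) (x : EuclideanSpace ℝ (Fin d)) : EuclideanSpace ℝ (Fin d) :=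
  (g.1 : ℝ)⁻¹ • x - g.2

theorem map_pullMap {d : ℕ} (g : AffineGp d) :
    Measure.map (pullMap g) volume =
      ENNReal.ofReal ((g.1 : ℝ) ^ d) • (volume : Measure (EuclideanSpace ℝ (Fin d))) := by
  have ha : (g.1 : ℝ)⁻¹ ≠ 0 := inv_ne_zero (coe_fst_ne_zero g)
  have h : pullMap g = (fun x => x - g.2) ∘ (fun x => (g.1 : ℝ)⁻¹ • x) := rfl
  rw [h, ← Measure.map_map (by fun_prop) (by fun_prop), Measure.map_addHaar_smul volume ha,
    Measure.map_smul, (measurePreserving_sub_right volume g.2).map_eq]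
  have : (0 : ℝ) < (g.1 : ℝ) := g.1.2
  congr 2
  simp [abs_of_pos this]

theorem measurable_pullMap {d : ℕ} (g : AffineGp d) : Measurable (pullMap g) := by
  unfold pullMap; fun_prop

theorem measurableEmbedding_pullMap {d : ℕ} (g : AffineGp d) :
    MeasurableEmbedding (pullMap g) := by
  have ha : (g.1 : ℝ)⁻¹ ≠ 0 := inv_ne_zero (coe_fst_ne_zero g)
  exact ((Homeomorph.smulOfNeZero _ ha).trans
    (Homeomorph.subRight g.2)).measurableEmbedding

theorem quasiMeasurePreserving_pullMap {d : ℕ} (g : AffineGp d) :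
    Measure.QuasiMeasurePreserving (pullMap g) volume volume :=
  ⟨measurable_pullMap g, by rw [map_pullMap]; exact Measure.smul_absolutelyContinuous⟩

theorem integral_comp_pullMap {d : ℕ} (g : AffineGp d) (F : EuclideanSpace ℝ (Fin d) → ℂ) :
    ∫ x, F (pullMap g x) = ((g.1 : ℝ) ^ d : ℝ) • ∫ x, F x := by
  rw [← (measurableEmbedding_pullMap g).integral_map, map_pullMap, integral_smul_measure,
    ENNReal.toReal_ofReal (by have : (0 : ℝ) < (g.1 : ℝ) := g.1.2; positivity)]

theorem atomFun_congr {d : ℕ} {f f' : EuclideanSpace ℝ (Fin d) → ℂ} (h : f =ᵐ[volume] f')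
    (g : AffineGp d) : atomFun f g =ᵐ[volume] atomFun f' g := by
  filter_upwards [(quasiMeasurePreserving_pullMap g).ae_eq_comp h] with x hx
  simp only [atomFun]
  congr 1

theorem coeFn_atom {d : ℕ} (φ : L2 d) (g : AffineGp d) :
    (atom φ g : EuclideanSpace ℝ (Fin d) → ℂ) =ᵐ[volume] atomFun φ g :=
  MemLp.coeFn_toLp _

theorem dilation_factor {d : ℕ} {a : ℝ} (ha : 0 < a) :
    a ^ (-((d : ℝ) / 2)) * a ^ (-((d : ℝ) / 2)) * a ^ d = 1 := by
  rw [← Real.rpow_add ha, ← Real.rpow_natCast, ← Real.rpow_add ha]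
  ring_nf
  simp

/-- The Jacobian `a^d` of the substitution cancels the two normalising factors `a^{-d/2}`. -/
theorem inner_atom_atom {d : ℕ} (f h : L2 d) (g : AffineGp d) :
    (inner ℂ (atom f g) (atom h g) : ℂ) = inner ℂ f h := by
  rw [L2.inner_def, L2.inner_def]
  have h1 : ∀ᵐ x, (inner ℂ (atom f g x) (atom h g x) : ℂ) =
      ((((g.1 : ℝ) ^ (-((d : ℝ) / 2))) * ((g.1 : ℝ) ^ (-((d : ℝ) / 2))) : ℝ) : ℂ) *
        (fun z => inner ℂ (f z) (h z)) (pullMap g x) := by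
    filter_upwards [coeFn_atom f g, coeFn_atom h g] with x h1 h2
    rw [h1, h2]
    simp only [atomFun, pullMap, RCLike.inner_apply, map_mul, Complex.conj_ofReal]
    push_cast
    ring
  rw [integral_congr_ae h1, integral_const_mul,
    integral_comp_pullMap g (fun z => inner ℂ (f z) (h z)), Complex.real_smul,
    ← mul_assoc, ← Complex.ofReal_mul, dilation_factor g.1.2, Complex.ofReal_one, one_mul]

theorem atom_add {d : ℕ} (f h : L2 d) (g : AffineGp d) :
    atom (f + h) g = atom f g + atom h g := by
  apply Lp.ext
  filter_upwards [coeFn_atom (f + h) g, coeFn_atom f g, coeFn_atom h g,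
    Lp.coeFn_add (atom f g) (atom h g), atomFun_congr (Lp.coeFn_add f h) g] with x h1 h2 h3 h4 h5
  rw [h1, h4, h5, Pi.add_apply, h2, h3]
  simp [atomFun, mul_add]

theorem atom_smul {d : ℕ} (c : ℂ) (f : L2 d) (g : AffineGp d) :
    atom (c • f) g = c • atom f g := by
  apply Lp.ext
  filter_upwards [coeFn_atom (c • f) g, coeFn_atom f g,
    Lp.coeFn_smul c (atom f g), atomFun_congr (Lp.coeFn_smul c f) g] with x h1 h2 h4 h5
  rw [h1, h4, h5, Pi.smul_apply, h2]
  simp [atomFun, mul_left_comm]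

theorem norm_atom {d : ℕ} (f : L2 d) (g : AffineGp d) : ‖atom f g‖ = ‖f‖ := by
  have h := inner_atom_atom f f g
  rw [inner_self_eq_norm_sq_to_K, inner_self_eq_norm_sq_to_K] at h
  have h2 : ‖atom f g‖ ^ 2 = ‖f‖ ^ 2 := by exact_mod_cast h
  exact (sq_eq_sq₀ (norm_nonneg _) (norm_nonneg _)).1 h2

/-- The unitary representation `f ↦ π(g) f` of the affine group. -/
def affRep {d : ℕ} (g : AffineGp d) : L2 d →ₗᵢ[ℂ] L2 d where
  toFun f := atom f g
  map_add' f h := atom_add f h g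
  map_smul' c f := atom_smul c f g
  norm_map' f := norm_atom f g

/-- This homomorphism property is what dictates the form of the product `affMul`. -/
theorem atom_atom {d : ℕ} (f : L2 d) (x y : AffineGp d) :
    atom (atom f y) x = atom f (affMul x y) := by
  apply Lp.ext
  filter_upwards [coeFn_atom (atom f y) x, coeFn_atom f (affMul x y),
    atomFun_congr (coeFn_atom f y) x] with z h1 h2 h3
  rw [h1, h2, h3]
  have hx : (0 : ℝ) < x.1 := x.1.2
  have hy : (0 : ℝ) < y.1 := y.1.2
  simp only [atomFun, affMul]
  rw [← mul_assoc, ← Complex.ofReal_mul, Real.mul_rpow hx.le hy.le, smul_sub, smul_smul, mul_inv,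
    mul_comm (x.1 : ℝ)⁻¹, sub_sub]

theorem inner_atom_affMul {d : ℕ} (φ f : L2 d) (x y : AffineGp d) :
    waveletTransform φ (atom f x) (affMul x y) = waveletTransform φ f y := by
  rw [waveletTransform, waveletTransform, ← atom_atom, inner_atom_atom]

/-- By unitarity the reproducing kernel depends on `y⁻¹x` only; its joint measurability thus reduces
to that of a single function on the group. -/
theorem inner_atom_eq {d : ℕ} (φ : L2 d) (x y : AffineGp d) :
    (inner ℂ (atom φ x) (atom φ y) : ℂ) = waveletTransform φ φ (affMul (affInv y) x) := by
  rw [← inner_atom_affMul φ φ y, affMul_affInv_cancel_left]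
  rfl

/-- The pointwise formula `atomFun`, unlike the class `atom`, is jointly measurable in the group
element and the point, so the transform is a measurable parametric integral. -/
theorem measurable_waveletTransform {d : ℕ} (φ f : L2 d) : Measurable (waveletTransform φ f) := by
  have h : waveletTransform φ f = fun g => ∫ x, inner ℂ (atomFun φ g x) (f x) := by
    ext g
    rw [waveletTransform, L2.inner_def]
    apply integral_congr_ae
    filter_upwards [coeFn_atom φ g] with x hx
    rw [hx]
  rw [h]
  have hφ : Measurable (φ : EuclideanSpace ℝ (Fin d) → ℂ) := (Lp.stronglyMeasurable φ).measurable
  have hf : Measurable (f : EuclideanSpace ℝ (Fin d) → ℂ) := (Lp.stronglyMeasurable f).measurable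
  have hm : Measurable (fun p : AffineGp d × EuclideanSpace ℝ (Fin d) =>
      (inner ℂ (atomFun φ p.1 p.2) (f p.2) : ℂ)) := by
    unfold atomFun
    refine Measurable.inner ?_ (hf.comp measurable_snd)
    refine Measurable.mul ?_ (hφ.comp ?_)
    · exact Complex.measurable_ofReal.comp
        ((measurable_subtype_coe.comp (measurable_fst.comp measurable_fst)).pow_const _)
    · exact ((measurable_subtype_coe.comp (measurable_fst.comp measurable_fst)).inv.smul
        measurable_snd).sub (measurable_snd.comp measurable_fst)
  exact (hm.stronglyMeasurable.integral_prod_right).measurable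

theorem measurable_inner_atom {d : ℕ} (φ : L2 d) :
    Measurable (fun p : AffineGp d × AffineGp d => (inner ℂ (atom φ p.1) (atom φ p.2) : ℂ)) := by
  simp_rw [inner_atom_eq]
  refine (measurable_waveletTransform φ φ).comp ?_
  exact (continuous_affMul.comp ((continuous_affInv.comp continuous_snd).prodMk
    continuous_fst)).measurable

theorem norm_waveletTransform_le {d : ℕ} (φ f : L2 d) (g : AffineGp d) :
    ‖waveletTransform φ f g‖ ≤ ‖φ‖ * ‖f‖ := by
  rw [← norm_atom φ g]
  exact norm_inner_le_norm _ _

/-! ### Left invariance of the Haar measure -/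

instance isLocallyFiniteMeasure_comap_Ioi :
    IsLocallyFiniteMeasure ((volume : Measure ℝ).comap ((↑) : Set.Ioi (0 : ℝ) → ℝ)) where
  finiteAtNhds x := by
    refine ⟨(↑) ⁻¹' Metric.ball (x : ℝ) 1,
      continuous_subtype_val.continuousAt.preimage_mem_nhds
        (Metric.ball_mem_nhds _ one_pos), ?_⟩
    rw [(MeasurableEmbedding.subtype_coe measurableSet_Ioi).comap_apply]
    exact (measure_mono (Set.image_preimage_subset _ _)).trans_lt measure_ball_lt_top

/-- The measure `da / a` on `(0, ∞)`. -/
def scaleMeasure : Measure (Set.Ioi (0 : ℝ)) :=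
  ((volume : Measure ℝ).comap ((↑) : Set.Ioi (0 : ℝ) → ℝ)).withDensity
    fun a => ENNReal.ofReal (a : ℝ)⁻¹

theorem measurable_scaleDensity :
    Measurable fun a : Set.Ioi (0 : ℝ) => ENNReal.ofReal (a : ℝ)⁻¹ := by fun_prop

instance isLocallyFiniteMeasure_scaleMeasure : IsLocallyFiniteMeasure scaleMeasure :=
  IsLocallyFiniteMeasure.withDensity_ofReal
    (continuous_subtype_val.inv₀ fun a => ne_of_gt a.2)

theorem haarAffine_eq_prod (d : ℕ) :
    haarAffine d = scaleMeasure.prod (volume : Measure (EuclideanSpace ℝ (Fin d))) := by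
  rw [scaleMeasure, prod_withDensity_left measurable_scaleDensity, haarAffine]

instance isLocallyFiniteMeasure_haarAffine (d : ℕ) : IsLocallyFiniteMeasure (haarAffine d) := by
  rw [haarAffine_eq_prod]; infer_instance

instance sigmaFinite_haarAffine (d : ℕ) : SigmaFinite (haarAffine d) := by
  rw [haarAffine_eq_prod]; infer_instance

/-- Multiplication by a positive number as a homeomorphism of `(0, ∞)`. -/
def scaleHomeo (c : Set.Ioi (0 : ℝ)) : Set.Ioi (0 : ℝ) ≃ₜ Set.Ioi (0 : ℝ) where
  toFun a := ⟨(c : ℝ) * a, Set.mem_Ioi.2 (mul_pos c.2 a.2)⟩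
  invFun a := ⟨(c : ℝ)⁻¹ * a, Set.mem_Ioi.2 (mul_pos (inv_pos.2 c.2) a.2)⟩
  left_inv a := by ext; exact inv_mul_cancel_left₀ (ne_of_gt (Set.mem_Ioi.1 c.2)) _
  right_inv a := by ext; exact mul_inv_cancel_left₀ (ne_of_gt (Set.mem_Ioi.1 c.2)) _
  continuous_toFun := by fun_prop
  continuous_invFun := by fun_prop

open scoped Pointwise in
theorem map_scaleHomeo_comap (c : Set.Ioi (0 : ℝ)) :
    ((volume : Measure ℝ).comap ((↑) : Set.Ioi (0 : ℝ) → ℝ)).map (scaleHomeo c) =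
      ENNReal.ofReal (c : ℝ)⁻¹ • (volume : Measure ℝ).comap ((↑) : Set.Ioi (0 : ℝ) → ℝ) := by
  have hc : (0 : ℝ) < c := c.2
  ext s hs
  have he := MeasurableEmbedding.subtype_coe (measurableSet_Ioi (a := (0 : ℝ)))
  rw [Measure.map_apply (scaleHomeo c).continuous.measurable hs, Measure.smul_apply,
    he.comap_apply, he.comap_apply, smul_eq_mul]
  have : (Subtype.val '' (scaleHomeo c ⁻¹' s) : Set ℝ) = (c : ℝ)⁻¹ • (Subtype.val '' s) := by
    ext x
    rw [Set.mem_smul_set_iff_inv_smul_mem₀ (inv_ne_zero hc.ne'), inv_inv, smul_eq_mul]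
    simp only [Set.mem_image, Set.mem_preimage, Subtype.exists, exists_and_right, exists_eq_right]
    constructor
    · rintro ⟨hx, h⟩
      exact ⟨Set.mem_Ioi.2 (mul_pos hc hx), h⟩
    · rintro ⟨hx, h⟩
      exact ⟨Set.mem_Ioi.2 (pos_of_mul_pos_right hx hc.le), h⟩
  rw [this, Measure.addHaar_smul]
  simp [abs_of_pos hc]

theorem measurePreserving_scaleHomeo (c : Set.Ioi (0 : ℝ)) :
    MeasurePreserving (scaleHomeo c) scaleMeasure scaleMeasure := by
  have hc : (0 : ℝ) < c := c.2
  refine ⟨(scaleHomeo c).continuous.measurable, ?_⟩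
  refine Measure.ext_of_lintegral _ fun F hF => ?_
  have hm := (scaleHomeo c).continuous.measurable
  rw [lintegral_map hF hm, scaleMeasure, lintegral_withDensity_eq_lintegral_mul _
    measurable_scaleDensity (g := fun a => F (scaleHomeo c a)) (hF.comp hm),
    lintegral_withDensity_eq_lintegral_mul _
    measurable_scaleDensity hF]
  have h1 : ∀ a : Set.Ioi (0 : ℝ),
      ((fun a : Set.Ioi (0 : ℝ) => ENNReal.ofReal (a : ℝ)⁻¹) * fun a => F (scaleHomeo c a)) a =
      ENNReal.ofReal (c : ℝ) * ((fun a : Set.Ioi (0 : ℝ) => ENNReal.ofReal (a : ℝ)⁻¹) * F)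
        (scaleHomeo c a) := by
    intro a
    simp only [Pi.mul_apply]
    rw [← mul_assoc, ← ENNReal.ofReal_mul hc.le]
    congr 2
    change (a : ℝ)⁻¹ = c * (c * a : ℝ)⁻¹
    rw [mul_inv, mul_inv_cancel_left₀ hc.ne']
  have h2 : Measurable fun a => ((fun a : Set.Ioi (0 : ℝ) => ENNReal.ofReal (a : ℝ)⁻¹) * F)
    (scaleHomeo c a) := (measurable_scaleDensity.mul hF).comp hm
  rw [lintegral_congr h1, lintegral_const_mul _ h2,
    ← lintegral_map (measurable_scaleDensity.mul hF) hm, map_scaleHomeo_comap,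
    lintegral_smul_measure, smul_eq_mul, ← mul_assoc, ← ENNReal.ofReal_mul hc.le,
    mul_inv_cancel₀ hc.ne', ENNReal.ofReal_one, one_mul]

/-- Left multiplication is a skew product: a dilation of `(0, ∞)`, which preserves `da/a`, and on
each fibre a translation, which preserves Lebesgue measure. -/
theorem measurePreserving_affMul {d : ℕ} (x : AffineGp d) :
    MeasurePreserving (affMul x) (haarAffine d) (haarAffine d) := by
  rw [haarAffine_eq_prod]
  refine MeasurePreserving.skew_product (f := scaleHomeo x.1)
    (g := fun a b => (a : ℝ)⁻¹ • x.2 + b) (measurePreserving_scaleHomeo x.1) ?_ ?_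
  · exact ((measurable_subtype_coe.comp measurable_fst).inv.smul_const x.2).add measurable_snd
  · exact Eventually.of_forall fun a => (measurePreserving_add_left volume _).map_eq

theorem lintegral_affMul {d : ℕ} (x : AffineGp d) (F : AffineGp d → ℝ≥0∞) :
    ∫⁻ y, F (affMul x y) ∂haarAffine d = ∫⁻ y, F y ∂haarAffine d :=
  (measurePreserving_affMul x).lintegral_comp_emb (affLeft x).measurableEmbedding F

theorem lintegral_haarAffine {d : ℕ} {F : AffineGp d → ℝ≥0∞} (hF : Measurable F) :
    ∫⁻ g, F g ∂haarAffine d =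
      ∫⁻ a, ∫⁻ b, F (a, b) ∂(volume : Measure (EuclideanSpace ℝ (Fin d))) ∂scaleMeasure := by
  rw [haarAffine_eq_prod, lintegral_prod _ hF.aemeasurable]

theorem lintegral_scaleMeasure {F : ℝ → ℝ≥0∞} (hF : Measurable F) :
    ∫⁻ a, F a ∂scaleMeasure = ∫⁻ a in Set.Ioi (0 : ℝ), F a * ENNReal.ofReal a⁻¹ := by
  rw [scaleMeasure, lintegral_withDensity_eq_lintegral_mul _ measurable_scaleDensity
    (g := fun a : Set.Ioi (0 : ℝ) => F a) (hF.comp measurable_subtype_coe),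
    ← lintegral_subtype_comap measurableSet_Ioi]
  simp [mul_comm]

/-! ### The Fourier transform on `L²` and its action on atoms -/

/-- Both transforms move onto the test function, one by the definition for tempered distributions
and the other by Fubini, so they agree against every smooth compactly supported function. -/
theorem fourier_toLp_ae_eq {d : ℕ} {G : EuclideanSpace ℝ (Fin d) → ℂ} (h1 : Integrable G)
    (h2 : MemLp G 2) :
    ((𝓕 (h2.toLp G : L2 d) : L2 d) : EuclideanSpace ℝ (Fin d) → ℂ) =ᵐ[volume] 𝓕 G := by
  have hcont : Continuous (𝓕 G : EuclideanSpace ℝ (Fin d) → ℂ) :=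
    VectorFourier.fourierIntegral_continuous Real.continuous_fourierChar
      (by exact continuous_inner) h1
  refine ae_eq_of_integral_contDiff_smul_eq
    ((Lp.memLp (𝓕 (h2.toLp G : L2 d))).locallyIntegrable one_le_two)
    hcont.locallyIntegrable fun g hg hgc => ?_
  have hc : HasCompactSupport (fun x => ((g x : ℝ) : ℂ)) := hgc.comp_left Complex.ofReal_zero
  have hd : ContDiff ℝ ((⊤ : ℕ∞) : WithTop ℕ∞) (fun x => ((g x : ℝ) : ℂ)) :=
    Complex.ofRealCLM.contDiff.comp hg
  set s := hc.toSchwartzMap hd with hs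
  have hsg : ∀ x, s x = ((g x : ℝ) : ℂ) := fun x => rfl
  have key := congrArg (fun T => T s)
    (Lp.fourier_toTemperedDistribution_eq (h2.toLp G : L2 d))
  simp only [TemperedDistribution.fourier_apply, Lp.toTemperedDistribution_apply] at key
  have e1 : ∫ x, g x • (𝓕 (h2.toLp G : L2 d) : L2 d) x =
      ∫ x, s x • (𝓕 (h2.toLp G : L2 d) : L2 d) x :=
    integral_congr_ae (Eventually.of_forall fun x => by simp [hsg])
  have e2 : ∫ x, g x • 𝓕 G x = ∫ x, s x • 𝓕 G x :=
    integral_congr_ae (Eventually.of_forall fun x => by simp [hsg])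
  rw [e1, e2, ← key]
  have e3 : ∫ x, (𝓕 s) x • (h2.toLp G) x = ∫ x, (𝓕 s) x • G x := by
    apply integral_congr_ae
    filter_upwards [h2.coeFn_toLp] with x hx
    rw [hx]
  rw [e3, SchwartzMap.fourier_coe]
  exact VectorFourier.integral_fourierIntegral_smul_eq_flip (L := innerₗ _)
    Real.continuous_fourierChar (by exact continuous_inner) s.integrable h1 |>.trans
    (by rw [flip_innerₗ]; rfl)

theorem eLpNorm_two_sq {α : Type*} [MeasurableSpace α] (μ : Measure α) (f : α → ℂ) :
    eLpNorm f 2 μ ^ 2 = ∫⁻ x, ‖f x‖ₑ ^ 2 ∂μ := by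
  rw [eLpNorm_eq_lintegral_rpow_enorm_toReal two_ne_zero ENNReal.ofNat_ne_top,
    ← ENNReal.rpow_natCast, ← ENNReal.rpow_mul]
  simp

theorem lintegral_enorm_fourier_sq {d : ℕ} {G : EuclideanSpace ℝ (Fin d) → ℂ} (h1 : Integrable G)
    (h2 : MemLp G 2) : ∫⁻ x, ‖𝓕 G x‖ₑ ^ 2 = ∫⁻ x, ‖G x‖ₑ ^ 2 := by
  have h : ‖𝓕 (h2.toLp G : L2 d)‖ₑ = ‖(h2.toLp G : L2 d)‖ₑ := by
    rw [← ofReal_norm, ← ofReal_norm, Lp.norm_fourier_eq]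
  rw [Lp.enorm_def, Lp.enorm_def, eLpNorm_congr_ae (fourier_toLp_ae_eq h1 h2),
    eLpNorm_congr_ae h2.coeFn_toLp] at h
  rw [← eLpNorm_two_sq, h, eLpNorm_two_sq]

theorem memLp_modulate {d : ℕ} (c : EuclideanSpace ℝ (Fin d)) (ψ : L2 d) :
    MemLp (fun x => (Real.fourierChar (-(inner ℝ c x : ℝ))) • ψ x) 2 volume := by
  refine (memLp_congr_norm ?_ (Lp.aestronglyMeasurable ψ) ?_).2 (Lp.memLp ψ)
  · have h : Continuous fun x => Real.fourierChar (-(inner ℝ c x : ℝ)) :=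
      Real.continuous_fourierChar.comp (by fun_prop)
    exact h.aestronglyMeasurable.smul (Lp.aestronglyMeasurable ψ)
  · exact Eventually.of_forall fun x => Circle.norm_smul _ _

/-- Modulation `ψ ↦ e^{-2πi⟨c, ·⟩} ψ` on `L²`. -/
def modulate {d : ℕ} (c : EuclideanSpace ℝ (Fin d)) : L2 d →ₗᵢ[ℂ] L2 d where
  toFun ψ := (memLp_modulate c ψ).toLp _
  map_add' f h := by
    apply Lp.ext
    filter_upwards [(memLp_modulate c (f + h)).coeFn_toLp, (memLp_modulate c f).coeFn_toLp,
      (memLp_modulate c h).coeFn_toLp, Lp.coeFn_add f h, Lp.coeFn_add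
      ((memLp_modulate c f).toLp _) ((memLp_modulate c h).toLp _)] with x h1 h2 h3 h4 h5
    rw [h1, h5, Pi.add_apply, h2, h3, h4, Pi.add_apply, smul_add]
  map_smul' z f := by
    apply Lp.ext
    filter_upwards [(memLp_modulate c (z • f)).coeFn_toLp, (memLp_modulate c f).coeFn_toLp,
      Lp.coeFn_smul z f, Lp.coeFn_smul z ((memLp_modulate c f).toLp _)] with x h1 h2 h4 h5
    rw [h1, RingHom.id_apply, h5, Pi.smul_apply, h2, h4, Pi.smul_apply, smul_comm]
  norm_map' f := by
    change ‖(memLp_modulate c f).toLp _‖ = _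
    rw [Lp.norm_def, Lp.norm_def, eLpNorm_congr_ae (memLp_modulate c f).coeFn_toLp]
    congr 1
    exact eLpNorm_congr_norm_ae (Eventually.of_forall fun x => Circle.norm_smul _ _)

theorem coeFn_modulate {d : ℕ} (c : EuclideanSpace ℝ (Fin d)) (ψ : L2 d) :
    (modulate c ψ : EuclideanSpace ℝ (Fin d) → ℂ) =ᵐ[volume]
      fun x => (Real.fourierChar (-(inner ℝ c x : ℝ))) • ψ x :=
  (memLp_modulate c ψ).coeFn_toLp

/-- The pure dilation `(a⁻¹, 0)`. -/
def dilInv {d : ℕ} (g : AffineGp d) : AffineGp d :=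
  (⟨(g.1 : ℝ)⁻¹, Set.mem_Ioi.2 (inv_pos.2 g.1.2)⟩, 0)

theorem fourier_atomFun {d : ℕ} (s : EuclideanSpace ℝ (Fin d) → ℂ) (g : AffineGp d)
    (η : EuclideanSpace ℝ (Fin d)) :
    𝓕 (atomFun s g) η =
      Real.fourierChar (-(inner ℝ ((g.1 : ℝ) • g.2) η : ℝ)) • atomFun (𝓕 s) (dilInv g) η := by
  have ha : (0 : ℝ) < g.1 := g.1.2
  have h1 : ∀ x, Real.fourierChar (-(inner ℝ x η : ℝ)) • atomFun s g x =
      (fun y => (((Real.fourierChar (-(inner ℝ ((g.1 : ℝ) • g.2) η : ℝ)) : Circle) : ℂ) *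
        (((g.1 : ℝ) ^ (-((d : ℝ) / 2)) : ℝ) : ℂ)) *
        (Real.fourierChar (-(inner ℝ y ((g.1 : ℝ) • η) : ℝ)) • s y)) (pullMap g x) := by
    intro x
    have hx : (inner ℝ x η : ℝ) = inner ℝ ((g.1 : ℝ) • g.2) η +
        inner ℝ (pullMap g x) ((g.1 : ℝ) • η) := by
      rw [real_inner_smul_right, real_inner_smul_left, pullMap, inner_sub_left,
        real_inner_smul_left]
      field_simp
      ring
    simp only [atomFun]
    rw [hx, neg_add, AddChar.map_add_eq_mul, Circle.smul_def, Circle.smul_def, smul_eq_mul,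
      smul_eq_mul, Circle.coe_mul]
    simp only [pullMap]
    ring
  rw [Real.fourier_eq, integral_congr_ae (Eventually.of_forall h1),
    integral_comp_pullMap g (fun y => (((Real.fourierChar
      (-(inner ℝ ((g.1 : ℝ) • g.2) η : ℝ)) : Circle) : ℂ) *
        (((g.1 : ℝ) ^ (-((d : ℝ) / 2)) : ℝ) : ℂ)) *
        (Real.fourierChar (-(inner ℝ y ((g.1 : ℝ) • η) : ℝ)) • s y)), integral_const_mul,
    ← Real.fourier_eq, atomFun, Circle.smul_def, smul_eq_mul, Complex.real_smul]
  have hfac : ((g.1 : ℝ)⁻¹ : ℝ) ^ (-((d : ℝ) / 2)) =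
      (g.1 : ℝ) ^ d * (g.1 : ℝ) ^ (-((d : ℝ) / 2)) := by
    rw [Real.inv_rpow ha.le, ← Real.rpow_neg ha.le, ← Real.rpow_natCast, ← Real.rpow_add ha]
    ring_nf
  simp only [dilInv, inv_inv, sub_zero]
  rw [hfac, Complex.ofReal_mul]
  ring

/-- Both sides are continuous in `φ`, so it suffices to treat Schwartz functions, where the integral
formula `fourier_atomFun` applies. -/
theorem fourier_atom {d : ℕ} (φ : L2 d) (g : AffineGp d) :
    (𝓕 (atom φ g) : L2 d) = modulate ((g.1 : ℝ) • g.2) (atom (𝓕 φ : L2 d) (dilInv g)) := by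
  refine DenseRange.induction_on (p := fun φ : L2 d => (𝓕 (atom φ g) : L2 d) =
    modulate ((g.1 : ℝ) • g.2) (atom (𝓕 φ : L2 d) (dilInv g)))
    (SchwartzMap.denseRange_toLpCLM (E := EuclideanSpace ℝ (Fin d)) (F := ℂ)
      (μ := volume) (p := 2) ENNReal.ofNat_ne_top) φ ?_ ?_
  · have hF : Continuous (fun φ : L2 d => (𝓕 φ : L2 d)) :=
      (Lp.fourierTransformₗᵢ (EuclideanSpace ℝ (Fin d)) ℂ).continuous
    have h1 : Continuous (fun φ : L2 d => (𝓕 (atom φ g) : L2 d)) :=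
      hF.comp (affRep g).continuous
    have h2 : Continuous (fun φ : L2 d => modulate ((g.1 : ℝ) • g.2)
        (atom (𝓕 φ : L2 d) (dilInv g))) :=
      (modulate _).continuous.comp ((affRep (dilInv g)).continuous.comp hF)
    exact isClosed_eq h1 h2
  · intro s
    rw [SchwartzMap.toLpCLM_apply]
    have hs : ((s.toLp 2 : L2 d) : EuclideanSpace ℝ (Fin d) → ℂ) =ᵐ[volume] s :=
      s.coeFn_toLp 2 volume
    have hFs : (((𝓕 s).toLp 2 : L2 d) : EuclideanSpace ℝ (Fin d) → ℂ) =ᵐ[volume]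
        (𝓕 (s : EuclideanSpace ℝ (Fin d) → ℂ)) := by
      rw [← SchwartzMap.fourier_coe]
      exact (𝓕 s).coeFn_toLp 2 volume
    have hSF : (𝓕 (s.toLp 2 : L2 d) : L2 d) = (𝓕 s).toLp 2 := SchwartzMap.toLp_fourier_eq s
    generalize (s.toLp 2 : L2 d) = S at *
    generalize ((𝓕 s).toLp 2 : L2 d) = S' at *
    have h2 : MemLp (atomFun s g) 2 volume :=
      (memLp_congr_ae (atomFun_congr hs g)).1 (memLp_atomFun S g)
    have h1 : Integrable (atomFun s g) := by
      refine Integrable.const_mul (f := fun x => s (pullMap g x)) ?_ _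
      refine ((measurableEmbedding_pullMap g).integrable_map_iff (g := s)).1 ?_
      rw [map_pullMap]
      exact s.integrable.smul_measure ENNReal.ofReal_ne_top
    have he : atom S g = h2.toLp _ := by
      apply Lp.ext
      filter_upwards [coeFn_atom S g, h2.coeFn_toLp, atomFun_congr hs g] with x h1 h2 h3
      rw [h1, h2, h3]
    rw [he, hSF]
    apply Lp.ext
    filter_upwards [fourier_toLp_ae_eq h1 h2, coeFn_modulate ((g.1 : ℝ) • g.2)
      (atom S' (dilInv g)), coeFn_atom S' (dilInv g), atomFun_congr hFs (dilInv g)] with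
      x h1 h2 h3 h4
    rw [h1, h2, h3, h4, fourier_atomFun]

/-! ### The wavelet transform is isometric -/

/-- The function whose Fourier transform gives the wavelet transform of `f` at scale `a`. -/
def scaleSlice {d : ℕ} (φ f : L2 d) (a : Set.Ioi (0 : ℝ)) (η : EuclideanSpace ℝ (Fin d)) : ℂ :=
  inner ℂ (atom (𝓕 φ : L2 d) (dilInv (a, 0)) η) ((𝓕 f : L2 d) η)

/-- Parseval turns the translation parameter `b` into a character, so at a fixed scale the transform
is itself a Fourier integral in `b`. -/
theorem waveletTransform_eq_fourier {d : ℕ} (φ f : L2 d) (a : Set.Ioi (0 : ℝ))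
    (b : EuclideanSpace ℝ (Fin d)) :
    waveletTransform φ f (a, b) = 𝓕 (scaleSlice φ f a) (-(a : ℝ) • b) := by
  rw [waveletTransform, ← Lp.inner_fourier_eq, fourier_atom, L2.inner_def, Real.fourier_eq]
  apply integral_congr_ae
  filter_upwards [coeFn_modulate ((a : ℝ) • b) (atom (𝓕 φ : L2 d) (dilInv (a, b)))] with η h
  rw [h, scaleSlice]
  have : dilInv (a, b) = dilInv (a, (0 : EuclideanSpace ℝ (Fin d))) := rfl
  rw [this, Circle.smul_def, Circle.smul_def, smul_eq_mul, smul_eq_mul, RCLike.inner_apply,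
    RCLike.inner_apply, map_mul, ← Circle.coe_inv_eq_conj, ← AddChar.map_neg_eq_inv]
  rw [neg_smul, inner_neg_right, real_inner_comm η]
  ring

theorem integrable_scaleSlice {d : ℕ} (φ f : L2 d) (a : Set.Ioi (0 : ℝ)) :
    Integrable (scaleSlice φ f a) :=
  L2.integrable_inner _ _

theorem enorm_scaleSlice_sq {d : ℕ} (φ f : L2 d) (a : Set.Ioi (0 : ℝ)) :
    ∀ᵐ η, ‖scaleSlice φ f a η‖ₑ ^ 2 = ENNReal.ofReal ((a : ℝ) ^ d) *
      (‖(𝓕 f : L2 d) η‖ₑ ^ 2 * ‖(𝓕 φ : L2 d) ((a : ℝ) • η)‖ₑ ^ 2) := by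
  have ha : (0 : ℝ) < a := a.2
  filter_upwards [coeFn_atom (𝓕 φ : L2 d) (dilInv (a, 0))] with η h
  have hfac : (((a : ℝ)⁻¹ : ℝ) ^ (-((d : ℝ) / 2))) ^ 2 = (a : ℝ) ^ d := by
    rw [Real.inv_rpow ha.le, ← Real.rpow_neg ha.le, ← Real.rpow_natCast, ← Real.rpow_mul ha.le,
      ← Real.rpow_natCast]
    congr 1
    push_cast
    ring
  rw [scaleSlice, h, atomFun, RCLike.inner_apply, map_mul, enorm_mul, enorm_mul, mul_pow, mul_pow]
  rw [RCLike.enorm_conj, RCLike.enorm_conj, ← hfac, ENNReal.ofReal_pow (by positivity)]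
  simp only [dilInv, inv_inv, sub_zero]
  rw [← ofReal_norm (((_ : ℝ) : ℂ)), Complex.norm_real, Real.norm_of_nonneg (by positivity)]
  ring

/-- Plancherel at a fixed scale. The slice is always in `L¹`; the finiteness hypothesis puts it in
`L²`. The Jacobian of `b ↦ -ab` cancels the factor `a^d`. -/
theorem lintegral_slice {d : ℕ} (φ f : L2 d) (a : Set.Ioi (0 : ℝ))
    (hfin : ∫⁻ η, ‖(𝓕 f : L2 d) η‖ₑ ^ 2 * ‖(𝓕 φ : L2 d) ((a : ℝ) • η)‖ₑ ^ 2 < ∞) :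
    ∫⁻ b, ‖waveletTransform φ f (a, b)‖ₑ ^ 2 =
      ∫⁻ η, ‖(𝓕 f : L2 d) η‖ₑ ^ 2 * ‖(𝓕 φ : L2 d) ((a : ℝ) • η)‖ₑ ^ 2 := by
  have ha : (0 : ℝ) < a := a.2
  have h1 := integrable_scaleSlice φ f a
  have he : ∫⁻ η, ‖scaleSlice φ f a η‖ₑ ^ 2 = ENNReal.ofReal ((a : ℝ) ^ d) *
      ∫⁻ η, ‖(𝓕 f : L2 d) η‖ₑ ^ 2 * ‖(𝓕 φ : L2 d) ((a : ℝ) • η)‖ₑ ^ 2 := by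
    rw [lintegral_congr_ae (enorm_scaleSlice_sq φ f a),
      lintegral_const_mul' _ _ ENNReal.ofReal_ne_top]
  have h2 : MemLp (scaleSlice φ f a) 2 := by
    refine ⟨h1.1, ?_⟩
    rw [eLpNorm_lt_top_iff_lintegral_rpow_enorm_lt_top two_ne_zero ENNReal.ofNat_ne_top]
    simp only [ENNReal.toReal_ofNat, ENNReal.rpow_ofNat]
    rw [he]
    exact ENNReal.mul_lt_top ENNReal.ofReal_lt_top hfin
  simp_rw [waveletTransform_eq_fourier]
  have hemb : MeasurableEmbedding (fun b : EuclideanSpace ℝ (Fin d) => (-(a : ℝ)) • b) :=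
    (Homeomorph.smulOfNeZero _ (neg_ne_zero.2 ha.ne')).measurableEmbedding
  rw [← hemb.lintegral_map (fun z => ‖𝓕 (scaleSlice φ f a) z‖ₑ ^ 2),
    Measure.map_addHaar_smul volume (neg_ne_zero.2 ha.ne'), lintegral_smul_measure,
    lintegral_enorm_fourier_sq h1 h2, he, smul_eq_mul, ← mul_assoc, ← ENNReal.ofReal_mul
    (abs_nonneg _)]
  have : |((-(a : ℝ)) ^ Module.finrank ℝ (EuclideanSpace ℝ (Fin d)))⁻¹| * (a : ℝ) ^ d = 1 := by
    rw [finrank_euclideanSpace_fin, abs_inv, abs_pow, abs_neg, abs_of_pos ha,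
      inv_mul_cancel₀ (pow_ne_zero _ ha.ne')]
  rw [this, ENNReal.ofReal_one, one_mul]

theorem lintegral_enorm_sq {d : ℕ} (f : L2 d) :
    ∫⁻ x, ‖f x‖ₑ ^ 2 = ENNReal.ofReal (‖f‖ ^ 2) := by
  rw [← eLpNorm_two_sq, ← Lp.enorm_def, ENNReal.ofReal_pow (norm_nonneg _), ofReal_norm]

/-- The wavelet transform of an admissible wavelet is isometric. -/
theorem lintegral_waveletTransform_sq {d : ℕ} {φ : L2 d} (hφ : Admissible φ) (f : L2 d) :
    ∫⁻ g, ‖waveletTransform φ f g‖ₑ ^ 2 ∂haarAffine d = ENNReal.ofReal (‖f‖ ^ 2) := by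
  have hmφ : Measurable ((𝓕 φ : L2 d) : EuclideanSpace ℝ (Fin d) → ℂ) :=
    (Lp.stronglyMeasurable _).measurable
  have hmf : Measurable ((𝓕 f : L2 d) : EuclideanSpace ℝ (Fin d) → ℂ) :=
    (Lp.stronglyMeasurable _).measurable
  have hm : Measurable (fun p : Set.Ioi (0 : ℝ) × EuclideanSpace ℝ (Fin d) =>
      ‖(𝓕 f : L2 d) p.2‖ₑ ^ 2 * ‖(𝓕 φ : L2 d) ((p.1 : ℝ) • p.2)‖ₑ ^ 2) := by
    refine ((hmf.comp measurable_snd).enorm.pow_const 2).mul ((hmφ.comp ?_).enorm.pow_const 2)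
    exact (measurable_subtype_coe.comp measurable_fst).smul measurable_snd
  -- Tonelli puts the scale integral inside, where admissibility makes it equal to 1 for almost
  -- every frequency.
  have htot : ∫⁻ a, (∫⁻ η, ‖(𝓕 f : L2 d) η‖ₑ ^ 2 * ‖(𝓕 φ : L2 d) ((a : ℝ) • η)‖ₑ ^ 2)
      ∂scaleMeasure = ENNReal.ofReal (‖f‖ ^ 2) := by
    rw [lintegral_lintegral_swap hm.aemeasurable, ← Lp.norm_fourier_eq f, ← lintegral_enorm_sq]
    apply lintegral_congr_ae
    filter_upwards [hφ] with η hη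
    have hmη : Measurable fun ξ : ℝ => ‖(𝓕 φ : L2 d) (ξ • η)‖ₑ ^ 2 :=
      (hmφ.comp (measurable_id.smul_const η)).enorm.pow_const 2
    have hmη' : Measurable fun ξ : Set.Ioi (0 : ℝ) => ‖(𝓕 φ : L2 d) ((ξ : ℝ) • η)‖ₑ ^ 2 :=
      hmη.comp measurable_subtype_coe
    rw [lintegral_const_mul _ hmη', lintegral_scaleMeasure hmη]
    have : ∫⁻ ξ in Set.Ioi (0 : ℝ), ‖(𝓕 φ : L2 d) (ξ • η)‖ₑ ^ 2 * ENNReal.ofReal ξ⁻¹ = 1 := by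
      rw [← hη]
      refine lintegral_congr fun ξ => ?_
      rw [div_eq_mul_inv, ENNReal.ofReal_mul (by positivity), ENNReal.ofReal_pow (norm_nonneg _),
        ofReal_norm]
    rw [this, mul_one]
  rw [lintegral_haarAffine ((measurable_waveletTransform φ f).enorm.pow_const 2), ← htot]
  -- The finite total makes almost every slice finite, as `lintegral_slice` requires.
  have hfin : ∀ᵐ a : Set.Ioi (0 : ℝ) ∂scaleMeasure,
      ∫⁻ η, ‖(𝓕 f : L2 d) η‖ₑ ^ 2 * ‖(𝓕 φ : L2 d) ((a : ℝ) • η)‖ₑ ^ 2 < ∞ :=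
    ae_lt_top hm.lintegral_prod_right' (by rw [htot]; exact ENNReal.ofReal_ne_top)
  apply lintegral_congr_ae
  filter_upwards [hfin] with a ha
  exact lintegral_slice φ f a ha

theorem eLpNorm_waveletTransform {d : ℕ} {φ : L2 d} (hφ : Admissible φ) (f : L2 d) :
    eLpNorm (waveletTransform φ f) 2 (haarAffine d) = ‖f‖ₑ := by
  have h := lintegral_waveletTransform_sq hφ f
  rw [← eLpNorm_two_sq, ENNReal.ofReal_pow (norm_nonneg _), ofReal_norm] at h
  exact (ENNReal.pow_right_strictMono two_ne_zero).injective h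

theorem memLp_waveletTransform {d : ℕ} {φ : L2 d} (hφ : Admissible φ) (f : L2 d) :
    MemLp (waveletTransform φ f) 2 (haarAffine d) :=
  ⟨(measurable_waveletTransform φ f).aestronglyMeasurable, by
    rw [eLpNorm_waveletTransform hφ]; exact enorm_lt_top⟩

/-! ### Toeplitz operators as `V* V` with `V f = √s · W_φ f` -/

theorem norm_sqrt_mul_le {s : ℝ} (hs : s ∈ Set.Icc (0 : ℝ) 1) (z : ℂ) :
    ‖((√s : ℝ) : ℂ) * z‖ ≤ ‖z‖ := by
  rw [norm_mul, Complex.norm_real, Real.norm_of_nonneg (Real.sqrt_nonneg _)]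
  exact mul_le_of_le_one_left (norm_nonneg _) (Real.sqrt_le_one.2 hs.2)

theorem memLp_weightedTransform {d : ℕ} {φ : L2 d} (hφ : Admissible φ) {s : AffineGp d → ℝ}
    (hm : Measurable s) (hs : ∀ g, s g ∈ Set.Icc (0 : ℝ) 1) (f : L2 d) :
    MemLp (fun g => ((√(s g) : ℝ) : ℂ) * waveletTransform φ f g) 2 (haarAffine d) :=
  (memLp_waveletTransform hφ f).mono
    ((Complex.measurable_ofReal.comp hm.sqrt).mul
      (measurable_waveletTransform φ f)).aestronglyMeasurable
    (Eventually.of_forall fun g => norm_sqrt_mul_le (hs g) _)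

theorem waveletTransform_add {d : ℕ} (φ f h : L2 d) (g : AffineGp d) :
    waveletTransform φ (f + h) g = waveletTransform φ f g + waveletTransform φ h g :=
  inner_add_right _ _ _

theorem waveletTransform_smul {d : ℕ} (φ f : L2 d) (c : ℂ) (g : AffineGp d) :
    waveletTransform φ (c • f) g = c * waveletTransform φ f g :=
  inner_smul_right _ _ _

/-- The operator `f ↦ √s · W_φ f` from `L²(ℝᵈ)` to `L²(λ)`. -/
def weightedTransform {d : ℕ} {φ : L2 d} (hφ : Admissible φ) {s : AffineGp d → ℝ}
    (hm : Measurable s) (hs : ∀ g, s g ∈ Set.Icc (0 : ℝ) 1) :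
    L2 d →L[ℂ] Lp ℂ 2 (haarAffine d) :=
  LinearMap.mkContinuous
    { toFun := fun f => (memLp_weightedTransform hφ hm hs f).toLp _
      map_add' := fun f h => by
        rw [← MemLp.toLp_add]
        congr 1
        ext g
        simp only [Pi.add_apply, waveletTransform_add, mul_add]
      map_smul' := fun c f => by
        rw [RingHom.id_apply, ← MemLp.toLp_const_smul]
        congr 1
        ext g
        simp only [Pi.smul_apply, waveletTransform_smul, smul_eq_mul]
        ring } 1 (fun f => by
      rw [one_mul]
      change ‖(memLp_weightedTransform hφ hm hs f).toLp _‖ ≤ _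
      rw [Lp.norm_toLp]
      refine ENNReal.toReal_le_of_le_ofReal (norm_nonneg _) ?_
      rw [ofReal_norm, ← eLpNorm_waveletTransform hφ f]
      exact eLpNorm_mono fun g => norm_sqrt_mul_le (hs g) _)

theorem coeFn_weightedTransform {d : ℕ} {φ : L2 d} (hφ : Admissible φ) {s : AffineGp d → ℝ}
    (hm : Measurable s) (hs : ∀ g, s g ∈ Set.Icc (0 : ℝ) 1) (f : L2 d) :
    weightedTransform hφ hm hs f =ᵐ[haarAffine d]
      fun g => ((√(s g) : ℝ) : ℂ) * waveletTransform φ f g :=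
  (memLp_weightedTransform hφ hm hs f).coeFn_toLp

/-- The Toeplitz operator with symbol `s`. -/
def toeplitz {d : ℕ} {φ : L2 d} (hφ : Admissible φ) {s : AffineGp d → ℝ}
    (hm : Measurable s) (hs : ∀ g, s g ∈ Set.Icc (0 : ℝ) 1) : L2 d →L[ℂ] L2 d :=
  (ContinuousLinearMap.adjoint (weightedTransform hφ hm hs)).comp (weightedTransform hφ hm hs)

theorem inner_weightedTransform_ae {d : ℕ} {φ : L2 d} (hφ : Admissible φ) {s : AffineGp d → ℝ}
    (hm : Measurable s) (hs : ∀ g, s g ∈ Set.Icc (0 : ℝ) 1) (f h : L2 d) :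
    (fun g => (inner ℂ (weightedTransform hφ hm hs h g) (weightedTransform hφ hm hs f g) : ℂ))
      =ᵐ[haarAffine d]
      fun x => (s x : ℂ) * (inner ℂ (atom φ x) f * inner ℂ h (atom φ x)) := by
  filter_upwards [coeFn_weightedTransform hφ hm hs f, coeFn_weightedTransform hφ hm hs h]
    with x h1 h2
  rw [h1, h2, RCLike.inner_apply, map_mul, Complex.conj_ofReal, waveletTransform, waveletTransform,
    inner_conj_symm]
  have : (s x : ℂ) = ((√(s x) : ℝ) : ℂ) * ((√(s x) : ℝ) : ℂ) := by
    rw [← Complex.ofReal_mul, Real.mul_self_sqrt (hs x).1]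
  rw [this]
  ring

theorem isToeplitz_toeplitz {d : ℕ} {φ : L2 d} (hφ : Admissible φ) {s : AffineGp d → ℝ}
    (hm : Measurable s) (hs : ∀ g, s g ∈ Set.Icc (0 : ℝ) 1) :
    IsToeplitz φ s (toeplitz hφ hm hs) := by
  intro f h
  have hae := inner_weightedTransform_ae hφ hm hs f h
  refine ⟨(L2.integrable_inner _ _).congr hae, ?_⟩
  rw [toeplitz, ContinuousLinearMap.comp_apply, ContinuousLinearMap.adjoint_inner_right,
    L2.inner_def, integral_congr_ae hae]

theorem IsToeplitz.inner_self {d : ℕ} {φ : L2 d} {s : AffineGp d → ℝ} {T : L2 d →L[ℂ] L2 d}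
    (hT : IsToeplitz φ s T) (f : L2 d) :
    (inner ℂ f (T f) : ℂ) =
      ((∫ g, s g * ‖waveletTransform φ f g‖ ^ 2 ∂haarAffine d : ℝ) : ℂ) := by
  rw [(hT f f).2, ← integral_complex_ofReal]
  congr 1
  ext g
  rw [waveletTransform, ← inner_conj_symm f, RCLike.mul_conj]
  push_cast
  rfl

theorem integrable_mul_waveletTransform_sq {d : ℕ} {φ : L2 d} (hφ : Admissible φ)
    {s : AffineGp d → ℝ} (hm : Measurable s) (hs : ∀ g, s g ∈ Set.Icc (0 : ℝ) 1) (f : L2 d) :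
    Integrable (fun g => s g * ‖waveletTransform φ f g‖ ^ 2) (haarAffine d) := by
  have h := (memLp_two_iff_integrable_sq_norm
    (measurable_waveletTransform φ f).aestronglyMeasurable).1 (memLp_waveletTransform hφ f)
  refine h.mono (hm.mul ((measurable_waveletTransform φ f).norm.pow_const 2)).aestronglyMeasurable
    (Eventually.of_forall fun g => ?_)
  rw [norm_mul, Real.norm_of_nonneg (hs g).1]
  exact mul_le_of_le_one_left (norm_nonneg _) (hs g).2

theorem ofReal_integral_mul_waveletTransform_sq {d : ℕ} {φ : L2 d} (hφ : Admissible φ)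
    {s : AffineGp d → ℝ} (hm : Measurable s) (hs : ∀ g, s g ∈ Set.Icc (0 : ℝ) 1) (f : L2 d) :
    ENNReal.ofReal (∫ g, s g * ‖waveletTransform φ f g‖ ^ 2 ∂haarAffine d) =
      ∫⁻ g, ENNReal.ofReal (s g) * ‖waveletTransform φ f g‖ₑ ^ 2 ∂haarAffine d := by
  rw [ofReal_integral_eq_lintegral_ofReal (integrable_mul_waveletTransform_sq hφ hm hs f)
    (Eventually.of_forall fun g => mul_nonneg (hs g).1 (by positivity))]
  refine lintegral_congr fun g => ?_
  rw [ENNReal.ofReal_mul (hs g).1, ENNReal.ofReal_pow (norm_nonneg _), ofReal_norm]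

/-! ### Schur's test -/

/-- Write `F = uH` and use `2 u(x) u(y) ≤ u(x)² + u(y)²`. By symmetry of `K` both halves give the
same integral, which `hη` bounds. Points with `S x = 0` contribute nothing, so the test inequality
is not needed there. -/
theorem lintegral_schur_le {α : Type*} [MeasurableSpace α] {μ : Measure α} [SFinite μ]
    {S F H : α → ℝ≥0∞} {K : α → α → ℝ≥0∞} (hS : Measurable S) (hF : Measurable F)
    (hH : Measurable H) (hK : Measurable (Function.uncurry K)) (hsymm : ∀ x y, K x y = K y x)
    (hFt : ∀ x, F x ≠ ∞) (hH0 : ∀ x, H x ≠ 0) (hHt : ∀ x, H x ≠ ∞) {η : ℝ≥0∞}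
    (hη : ∀ x, S x ≠ 0 → ∫⁻ y, S y * K x y * H y ∂μ ≤ η * H x) :
    ∫⁻ x, ∫⁻ y, S x * S y * F x * F y * K x y ∂μ ∂μ ≤ η * ∫⁻ x, S x * F x ^ 2 ∂μ := by
  set u : α → ℝ≥0∞ := fun x => F x / H x with hu
  have hum : Measurable u := hF.div hH
  have hut : ∀ x, u x ≠ ∞ := fun x => ENNReal.div_ne_top (hFt x) (hH0 x)
  have huF : ∀ x, F x = u x * H x := fun x => (ENNReal.div_mul_cancel (hH0 x) (hHt x)).symm
  set J := ∫⁻ x, ∫⁻ y, S x * S y * K x y * H x * H y * u x ^ 2 ∂μ ∂μ with hJ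
  have hJm : Measurable (Function.uncurry fun x y => S x * S y * K x y * H x * H y * u x ^ 2) := by
    have hS1 : Measurable fun p : α × α => S p.1 := hS.comp measurable_fst
    have hS2 : Measurable fun p : α × α => S p.2 := hS.comp measurable_snd
    have hH1 : Measurable fun p : α × α => H p.1 := hH.comp measurable_fst
    have hH2 : Measurable fun p : α × α => H p.2 := hH.comp measurable_snd
    have hu1 : Measurable fun p : α × α => u p.1 := hum.comp measurable_fst
    exact ((((hS1.mul hS2).mul hK).mul hH1).mul hH2).mul (hu1.pow_const 2)
  have hJ2 : ∫⁻ x, ∫⁻ y, S x * S y * K x y * H x * H y * u y ^ 2 ∂μ ∂μ = J := by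
    rw [hJ, lintegral_lintegral_swap hJm.aemeasurable]
    refine lintegral_congr fun x => lintegral_congr fun y => ?_
    rw [hsymm y x]
    ring
  have h2 : 2 * ∫⁻ x, ∫⁻ y, S x * S y * F x * F y * K x y ∂μ ∂μ ≤ 2 * J := by
    calc 2 * ∫⁻ x, ∫⁻ y, S x * S y * F x * F y * K x y ∂μ ∂μ
        = ∫⁻ x, ∫⁻ y, 2 * (S x * S y * F x * F y * K x y) ∂μ ∂μ := by
          rw [← lintegral_const_mul' _ _ ENNReal.ofNat_ne_top]
          refine lintegral_congr fun x => ?_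
          rw [lintegral_const_mul' _ _ ENNReal.ofNat_ne_top]
      _ ≤ ∫⁻ x, ∫⁻ y, (S x * S y * K x y * H x * H y * u x ^ 2 +
            S x * S y * K x y * H x * H y * u y ^ 2) ∂μ ∂μ := by
          refine lintegral_mono fun x => lintegral_mono fun y => ?_
          have hxy : 2 * (u x * u y) ≤ u x ^ 2 + u y ^ 2 := by
            lift u x to NNReal using hut x with a
            lift u y to NNReal using hut y with b
            rw [← mul_assoc]
            exact_mod_cast two_mul_le_add_sq a b
          calc 2 * (S x * S y * F x * F y * K x y)
              = S x * S y * K x y * H x * H y * (2 * (u x * u y)) := by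
                rw [huF x, huF y]; ring
            _ ≤ S x * S y * K x y * H x * H y * (u x ^ 2 + u y ^ 2) := by gcongr
            _ = _ := by ring
      _ = J + J := by
          nth_rewrite 2 [← hJ2]
          have hJx : Measurable fun x =>
              ∫⁻ y, S x * S y * K x y * H x * H y * u x ^ 2 ∂μ := hJm.lintegral_prod_right'
          rw [hJ, ← lintegral_add_left hJx]
          refine lintegral_congr fun x => ?_
          have hJy : Measurable fun y => S x * S y * K x y * H x * H y * u x ^ 2 :=
            hJm.comp measurable_prodMk_left
          rw [lintegral_add_left hJy]
      _ = 2 * J := (two_mul J).symm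
  have h3 : J ≤ η * ∫⁻ x, S x * F x ^ 2 ∂μ := by
    have hSF : Measurable fun x => S x * F x ^ 2 := hS.mul (hF.pow_const 2)
    rw [← lintegral_const_mul _ hSF, hJ]
    refine lintegral_mono fun x => ?_
    have e : ∀ y, S x * S y * K x y * H x * H y * u x ^ 2 =
        S x * H x * u x ^ 2 * (S y * K x y * H y) := fun y => by ring
    simp_rw [e]
    have hSK : Measurable fun y => S y * K x y * H y :=
      (hS.mul (hK.comp measurable_prodMk_left)).mul hH
    rw [lintegral_const_mul _ hSK]
    by_cases hx : S x = 0
    · simp [hx]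
    · calc S x * H x * u x ^ 2 * ∫⁻ y, S y * K x y * H y ∂μ
          ≤ S x * H x * u x ^ 2 * (η * H x) := by gcongr; exact hη x hx
        _ = η * (S x * F x ^ 2) := by rw [huF x]; ring
  exact ((ENNReal.mul_le_mul_iff_right two_ne_zero ENNReal.ofNat_ne_top).1 h2).trans h3

theorem IsToeplitz.enorm_waveletTransform_le {d : ℕ} {φ : L2 d} {s : AffineGp d → ℝ}
    {T : L2 d →L[ℂ] L2 d} (hT : IsToeplitz φ s T) (hs : ∀ g, s g ∈ Set.Icc (0 : ℝ) 1) (f : L2 d)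
    (x : AffineGp d) :
    ‖waveletTransform φ (T f) x‖ₑ ≤ ∫⁻ y, ENNReal.ofReal (s y) * ‖waveletTransform φ f y‖ₑ *
      ‖(inner ℂ (atom φ x) (atom φ y) : ℂ)‖ₑ ∂haarAffine d := by
  rw [waveletTransform, (hT f (atom φ x)).2]
  refine (enorm_integral_le_lintegral_enorm _).trans (le_of_eq ?_)
  refine lintegral_congr fun y => ?_
  rw [enorm_mul, enorm_mul, ← mul_assoc, ← ofReal_norm ((s y : ℝ) : ℂ), Complex.norm_real,
    Real.norm_of_nonneg (hs y).1, waveletTransform]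

/-- Schur's test for Toeplitz operators. -/
theorem lintegral_mul_waveletTransform_sq_le {d : ℕ} {φ : L2 d} (hφ : Admissible φ)
    {s : AffineGp d → ℝ} (hm : Measurable s) (hs : ∀ g, s g ∈ Set.Icc (0 : ℝ) 1)
    {h : AffineGp d → ℝ} (hh : Measurable h) (hpos : ∀ g, 0 < h g) {η : ℝ≥0∞}
    (hη : ∀ x, s x ≠ 0 → ∫⁻ y, ENNReal.ofReal (s y) * ‖(inner ℂ (atom φ x) (atom φ y) : ℂ)‖ₑ *
      ENNReal.ofReal (h y) ∂haarAffine d ≤ η * ENNReal.ofReal (h x)) (f : L2 d) :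
    ∫⁻ g, ENNReal.ofReal (s g) * ‖waveletTransform φ f g‖ₑ ^ 2 ∂haarAffine d ≤
      η * ENNReal.ofReal (‖f‖ ^ 2) := by
  set T := toeplitz hφ hm hs with hTdef
  have hT : IsToeplitz φ s T := isToeplitz_toeplitz hφ hm hs
  set A := ∫⁻ g, ENNReal.ofReal (s g) * ‖waveletTransform φ f g‖ₑ ^ 2 ∂haarAffine d with hA
  have hAr := ofReal_integral_mul_waveletTransform_sq hφ hm hs f
  have hAt : A ≠ ∞ := by rw [hA, ← hAr]; exact ENNReal.ofReal_ne_top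
  have hS : Measurable fun g => ENNReal.ofReal (s g) := hm.ennreal_ofReal
  have hF : Measurable fun g => ‖waveletTransform φ f g‖ₑ := (measurable_waveletTransform φ f).enorm
  have hK : Measurable (Function.uncurry fun x y => ‖(inner ℂ (atom φ x) (atom φ y) : ℂ)‖ₑ) :=
    (measurable_inner_atom φ).enorm
  have hschur := lintegral_schur_le (μ := haarAffine d) hS hF hh.ennreal_ofReal hK
    (fun x y => by rw [← inner_conj_symm, RCLike.enorm_conj]) (fun x => enorm_ne_top)
    (fun x => (ENNReal.ofReal_pos.2 (hpos x)).ne') (fun x => ENNReal.ofReal_ne_top) (η := η)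
    (fun x hx => hη x fun h0 => hx (by rw [h0, ENNReal.ofReal_zero]))
  -- Expanding `⟨T f, T f⟩` weakly, and then `W_φ (T f)` once more, gives the double integral of
  -- Schur's test.
  have h1 : ‖T f‖ₑ ^ 2 ≤ η * A := by
    have e1 : ‖T f‖ₑ ^ 2 = ‖(inner ℂ (T f) (T f) : ℂ)‖ₑ := by
      rw [inner_self_eq_norm_sq_to_K, enorm_pow]
      congr 1
      simp [enorm_eq_nnnorm]
    rw [e1, (hT f (T f)).2]
    refine (enorm_integral_le_lintegral_enorm _).trans (le_trans ?_ hschur)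
    refine lintegral_mono fun x => ?_
    rw [enorm_mul, enorm_mul, ← ofReal_norm ((s x : ℝ) : ℂ), Complex.norm_real,
      Real.norm_of_nonneg (hs x).1, ← inner_conj_symm, RCLike.enorm_conj, ← mul_assoc]
    calc ENNReal.ofReal (s x) * ‖(inner ℂ f (atom φ x) : ℂ)‖ₑ * ‖(inner ℂ (T f) (atom φ x) : ℂ)‖ₑ
        = ENNReal.ofReal (s x) * ‖waveletTransform φ f x‖ₑ * ‖waveletTransform φ (T f) x‖ₑ := by
          rw [waveletTransform, waveletTransform, ← inner_conj_symm (atom φ x) f,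
            ← inner_conj_symm (atom φ x) (T f), RCLike.enorm_conj, RCLike.enorm_conj]
      _ ≤ ENNReal.ofReal (s x) * ‖waveletTransform φ f x‖ₑ *
          ∫⁻ y, ENNReal.ofReal (s y) * ‖waveletTransform φ f y‖ₑ *
            ‖(inner ℂ (atom φ x) (atom φ y) : ℂ)‖ₑ ∂haarAffine d := by
          gcongr; exact hT.enorm_waveletTransform_le hs f x
      _ = _ := by
          rw [← lintegral_const_mul' _ _ (ENNReal.mul_ne_top ENNReal.ofReal_ne_top enorm_ne_top)]
          refine lintegral_congr fun y => ?_
          ring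
  have h2 : A ≤ ‖f‖ₑ * ‖T f‖ₑ := by
    have e : A = ‖(inner ℂ f (T f) : ℂ)‖ₑ := by
      rw [hT.inner_self, ← ofReal_norm, Complex.norm_real, Real.norm_of_nonneg, hA, hAr]
      exact integral_nonneg fun g => mul_nonneg (hs g).1 (by positivity)
    rw [e, ← ofReal_norm f, ← ofReal_norm (T f), ← ofReal_norm (inner ℂ f (T f) : ℂ),
      ← ENNReal.ofReal_mul (norm_nonneg _)]
    exact ENNReal.ofReal_le_ofReal (norm_inner_le_norm _ _)
  by_cases hA0 : A = 0
  · rw [hA0]; exact zero_le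
  -- From `A ≤ ‖f‖ ‖T f‖` and `‖T f‖² ≤ η A`; one factor `A`, nonzero and finite, is then cancelled.
  have h3 : A * A ≤ A * (η * ENNReal.ofReal (‖f‖ ^ 2)) := by
    calc A * A ≤ (‖f‖ₑ * ‖T f‖ₑ) * (‖f‖ₑ * ‖T f‖ₑ) := by gcongr
      _ = ‖f‖ₑ ^ 2 * ‖T f‖ₑ ^ 2 := by ring
      _ ≤ ‖f‖ₑ ^ 2 * (η * A) := by gcongr
      _ = _ := by rw [ENNReal.ofReal_pow (norm_nonneg _), ofReal_norm]; ring
  exact (ENNReal.mul_le_mul_iff_right hA0 hAt).1 h3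

/-! ### From thinness to small tails -/

instance locallyCompactSpace_Ioi : LocallyCompactSpace (Set.Ioi (0 : ℝ)) :=
  isOpen_Ioi.isOpenEmbedding_subtypeVal.locallyCompactSpace

/-- Inner regularity of the finite measure with density `F`. -/
theorem exists_isCompact_setLIntegral_compl_le {d : ℕ} {F : AffineGp d → ℝ≥0∞}
    (hfin : ∫⁻ g, F g ∂haarAffine d ≠ ∞) {η : ℝ≥0∞} (hη : η ≠ 0) :
    ∃ B : Set (AffineGp d), IsCompact B ∧ ∫⁻ g in Bᶜ, F g ∂haarAffine d ≤ η := by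
  have : IsFiniteMeasure ((haarAffine d).withDensity F) := isFiniteMeasure_withDensity hfin
  obtain ⟨B, -, hB, h⟩ := MeasurableSet.univ.exists_isCompact_sdiff_lt
    (measure_ne_top ((haarAffine d).withDensity F) Set.univ) hη
  refine ⟨B, hB, ?_⟩
  rw [← Set.compl_eq_univ_sdiff, withDensity_apply _ hB.measurableSet.compl] at h
  exact h.le

theorem measurable_weight (d : ℕ) (ε : ℝ) : Measurable (weight d ε) :=
  (measurable_subtype_coe.comp measurable_fst).pow_const _

theorem weight_pos {d : ℕ} (ε : ℝ) (g : AffineGp d) : 0 < weight d ε g :=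
  Real.rpow_pos_of_pos g.1.2 _

theorem continuous_weight (d : ℕ) (ε : ℝ) : Continuous (weight d ε) :=
  (continuous_subtype_val.comp continuous_fst).rpow_const fun g => Or.inl (coe_fst_ne_zero g)

/-- Multiplicativity lets the factor `w(x)` leave the Schur integral, which makes the weight a
suitable test function. -/
theorem weight_affMul {d : ℕ} (ε : ℝ) (x y : AffineGp d) :
    weight d ε (affMul x y) = weight d ε x * weight d ε y :=
  Real.mul_rpow (Set.mem_Ioi.1 x.1.2).le (Set.mem_Ioi.1 y.1.2).le

theorem enorm_inner_atom_affMul {d : ℕ} (φ : L2 d) (x z : AffineGp d) :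
    ‖(inner ℂ (atom φ x) (atom φ (affMul x z)) : ℂ)‖ₑ = ‖waveletTransform φ φ z‖ₑ := by
  rw [← inner_conj_symm, RCLike.enorm_conj, ← inner_atom_affMul φ φ x z]
  rfl

/-- Left invariance recentres the Berezin integral at the identity: `x` moves into the symbol and
the fixed density `|W_φ φ|²` remains. -/
theorem lintegral_berezin {d : ℕ} {φ : L2 d} (hφ : Admissible φ) {σ : AffineGp d → ℝ}
    (hm : Measurable σ) (hσ : ∀ g, σ g ∈ Set.Icc (0 : ℝ) 1) (x : AffineGp d) :
    ∫⁻ z, ENNReal.ofReal (σ (affMul x z)) * ‖waveletTransform φ φ z‖ₑ ^ 2 ∂haarAffine d =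
      ENNReal.ofReal (berezin φ σ x) := by
  have h := ofReal_integral_mul_waveletTransform_sq hφ hm hσ (atom φ x)
  have e : ∫ g, σ g * ‖waveletTransform φ (atom φ x) g‖ ^ 2 ∂haarAffine d = berezin φ σ x := by
    rw [berezin]
    congr 1
    ext g
    rw [waveletTransform, ← inner_conj_symm, RCLike.norm_conj]
  rw [← e, h, ← lintegral_affMul x
    (fun g => ENNReal.ofReal (σ g) * ‖waveletTransform φ (atom φ x) g‖ₑ ^ 2)]
  refine lintegral_congr fun z => ?_
  rw [inner_atom_affMul]

/-- The weighted wavelet energy outside of suitable compact sets is uniformly small. -/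
def HasSmallTails {d : ℕ} (φ : L2 d) (σ : AffineGp d → ℝ) : Prop :=
  ∀ δ : ℝ, 0 < δ → ∃ K : Set (AffineGp d), IsCompact K ∧ ∀ f : L2 d,
    ∫⁻ g in Kᶜ, ENNReal.ofReal (σ g) * ‖waveletTransform φ f g‖ₑ ^ 2 ∂haarAffine d ≤
      ENNReal.ofReal δ * ENNReal.ofReal (‖f‖ ^ 2)

theorem lintegral_enorm_waveletTransform_mul_weight_ne_top {d : ℕ} {φ : L2 d} {ε : ℝ}
    (hε : φ ∈ classB (weight d ε)) :
    ∫⁻ z, ‖waveletTransform φ φ z‖ₑ * ENNReal.ofReal (weight d ε z) ∂haarAffine d ≠ ∞ := by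
  have h := hε.2
  rw [hasFiniteIntegral_iff_enorm, lintegral_withDensity_eq_lintegral_mul _
    (measurable_weight d ε).ennreal_ofReal (measurable_waveletTransform φ φ).enorm] at h
  simpa [mul_comm] using h.ne

theorem lintegral_mul_le_sqrt {α : Type*} [MeasurableSpace α] {μ : Measure α} {p q : α → ℝ≥0∞}
    (hp : AEMeasurable p μ) (hq : AEMeasurable q μ) {P Q : ℝ≥0∞} (hP : ∫⁻ x, p x ^ 2 ∂μ ≤ P ^ 2)
    (hQ : ∫⁻ x, q x ^ 2 ∂μ ≤ Q ^ 2) : ∫⁻ x, p x * q x ∂μ ≤ P * Q := by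
  have h := ENNReal.lintegral_mul_le_Lp_mul_Lq μ Real.HolderConjugate.two_two hp hq
  have hr : ∀ {z : ℝ≥0∞}, (z ^ 2) ^ (1 / (2 : ℝ)) = z := fun {z} => by
    rw [← ENNReal.rpow_natCast, ← ENNReal.rpow_mul]; simp
  refine h.trans ?_
  rw [← hr (z := P), ← hr (z := Q)]
  simp only [ENNReal.rpow_ofNat]
  gcongr

theorem IsThin.hasSmallTails {d : ℕ} {φ : L2 d} (hφ : φ ∈ classA1 d) {σ : AffineGp d → ℝ}
    (hσ : ∀ g, σ g ∈ Set.Icc (0 : ℝ) 1) (hthin : IsThin φ σ) : HasSmallTails φ σ := by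
  obtain ⟨hB, hadm⟩ := hφ
  replace hadm : Admissible φ := hadm
  simp only [Set.mem_iUnion] at hB
  obtain ⟨ε, -, hε⟩ := hB
  obtain ⟨hm, hlim⟩ := hthin
  intro δ hδ
  have hWm : Measurable fun z => ‖waveletTransform φ φ z‖ₑ :=
    (measurable_waveletTransform φ φ).enorm
  have hHm : Measurable fun z => ENNReal.ofReal (weight d ε z) :=
    (measurable_weight d ε).ennreal_ofReal
  obtain ⟨B, hBc, hBη⟩ := exists_isCompact_setLIntegral_compl_le
    (lintegral_enorm_waveletTransform_mul_weight_ne_top hε)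
    (ENNReal.ofReal_pos.2 (half_pos hδ)).ne'
  obtain ⟨C, hC0, hC⟩ : ∃ C : ℝ, 0 < C ∧
      ∫⁻ z in B, ENNReal.ofReal (weight d ε z) ^ 2 ∂haarAffine d ≤ ENNReal.ofReal C ^ 2 := by
    have hfin : ∫⁻ z in B, ENNReal.ofReal (weight d ε z) ^ 2 ∂haarAffine d ≠ ∞ := by
      obtain ⟨M, hM⟩ := (hBc.image (continuous_weight d ε)).bddAbove
      refine ((setLIntegral_mono measurable_const (g := fun _ => ENNReal.ofReal M ^ 2)
        fun z hz => ?_).trans_lt ?_).ne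
      · gcongr
        exact hM (Set.mem_image_of_mem _ hz)
      · rw [setLIntegral_const]
        exact ENNReal.mul_lt_top (ENNReal.pow_lt_top ENNReal.ofReal_lt_top) hBc.measure_lt_top
    -- With `I` the integral, `C = I + 1` is positive and satisfies `I ≤ C²`.
    refine ⟨(∫⁻ z in B, ENNReal.ofReal (weight d ε z) ^ 2 ∂haarAffine d).toReal + 1,
      by positivity, ?_⟩
    set I := ∫⁻ z in B, ENNReal.ofReal (weight d ε z) ^ 2 ∂haarAffine d
    rw [← ENNReal.ofReal_pow (by positivity)]
    refine ENNReal.le_ofReal_iff_toReal_le hfin (by positivity) |>.2 ?_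
    nlinarith [ENNReal.toReal_nonneg (a := I)]
  -- This threshold for the Berezin transform makes the Cauchy-Schwarz bound on `B` equal to `(δ / 2
  -- / C) · C = δ / 2`.
  have hδC : (0 : ℝ) < (δ / 2 / C) ^ 2 := by positivity
  have hev := hlim.eventually (gt_mem_nhds hδC)
  obtain ⟨K, hKc, hK⟩ := mem_cocompact.1 hev
  refine ⟨K, hKc, fun f => ?_⟩
  set s : AffineGp d → ℝ := Kᶜ.indicator σ with hs
  have hsm : Measurable s := hm.indicator hKc.measurableSet.compl
  have hs_le : ∀ g, s g ≤ σ g := fun g =>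
    Set.indicator_le_self' (fun _ _ => (hσ g).1) g
  have hs01 : ∀ g, s g ∈ Set.Icc (0 : ℝ) 1 := fun g =>
    ⟨Set.indicator_nonneg (fun g _ => (hσ g).1) g, (hs_le g).trans (hσ g).2⟩
  have hmain := lintegral_mul_waveletTransform_sq_le hadm hsm hs01 (measurable_weight d ε)
    (weight_pos ε) (η := ENNReal.ofReal δ) ?_ f
  · rw [← lintegral_indicator hKc.measurableSet.compl]
    refine le_trans (le_of_eq (lintegral_congr fun g => ?_)) hmain
    by_cases hg : g ∈ Kᶜ
    · simp [hs, hg]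
    · simp [hs, hg]
  · intro x hx
    have hxK : x ∈ Kᶜ := by
      by_contra h
      exact hx (Set.indicator_of_notMem h σ)
    have hber : berezin φ σ x < (δ / 2 / C) ^ 2 := hK hxK
    have hsx : Measurable fun z => ENNReal.ofReal (s (affMul x z)) :=
      (hsm.comp (measurePreserving_affMul x).measurable).ennreal_ofReal
    rw [← lintegral_affMul x]
    have e : ∀ z, ENNReal.ofReal (s (affMul x z)) *
        ‖(inner ℂ (atom φ x) (atom φ (affMul x z)) : ℂ)‖ₑ *
        ENNReal.ofReal (weight d ε (affMul x z)) =
        ENNReal.ofReal (weight d ε x) * (ENNReal.ofReal (s (affMul x z)) *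
          ‖waveletTransform φ φ z‖ₑ * ENNReal.ofReal (weight d ε z)) := fun z => by
      rw [enorm_inner_atom_affMul, weight_affMul, ENNReal.ofReal_mul (weight_pos ε x).le]
      ring
    rw [lintegral_congr e, lintegral_const_mul' _ _ ENNReal.ofReal_ne_top, mul_comm]
    gcongr
    rw [← lintegral_add_compl _ hBc.measurableSet]
    have hin : ∫⁻ z in B, ENNReal.ofReal (s (affMul x z)) * ‖waveletTransform φ φ z‖ₑ *
        ENNReal.ofReal (weight d ε z) ∂haarAffine d ≤ ENNReal.ofReal (δ / 2) := by
      have hP : ∫⁻ z in B, (ENNReal.ofReal (s (affMul x z)) * ‖waveletTransform φ φ z‖ₑ) ^ 2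
          ∂haarAffine d ≤ ENNReal.ofReal (δ / 2 / C) ^ 2 := by
        calc _ ≤ ∫⁻ z, (ENNReal.ofReal (s (affMul x z)) * ‖waveletTransform φ φ z‖ₑ) ^ 2
              ∂haarAffine d := setLIntegral_le_lintegral _ _
          _ ≤ ∫⁻ z, ENNReal.ofReal (σ (affMul x z)) * ‖waveletTransform φ φ z‖ₑ ^ 2
              ∂haarAffine d := by
            -- Since `0 ≤ s ≤ 1` and `s ≤ σ`, also `s² ≤ σ`; this is how the Berezin transform
            -- enters.
            refine lintegral_mono fun z => ?_
            rw [mul_pow]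
            gcongr
            rw [← ENNReal.ofReal_pow (hs01 _).1]
            refine ENNReal.ofReal_le_ofReal (le_trans ?_ (hs_le _))
            exact pow_le_of_le_one (hs01 _).1 (hs01 _).2 two_ne_zero
          _ = ENNReal.ofReal (berezin φ σ x) := lintegral_berezin hadm hm hσ x
          _ ≤ _ := by
            rw [← ENNReal.ofReal_pow (by positivity)]
            exact ENNReal.ofReal_le_ofReal hber.le
      refine (lintegral_mul_le_sqrt (hsx.mul hWm).aemeasurable hHm.aemeasurable hP hC).trans
        (le_of_eq ?_)
      rw [← ENNReal.ofReal_mul (by positivity), div_mul_cancel₀ _ hC0.ne']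
    have hout : ∫⁻ z in Bᶜ, ENNReal.ofReal (s (affMul x z)) * ‖waveletTransform φ φ z‖ₑ *
        ENNReal.ofReal (weight d ε z) ∂haarAffine d ≤ ENNReal.ofReal (δ / 2) := by
      refine le_trans (lintegral_mono fun z => ?_) hBη
      refine mul_le_mul_left ?_ _
      exact mul_le_of_le_one_left zero_le (ENNReal.ofReal_le_one.2 (hs01 _).2)
    calc _ ≤ ENNReal.ofReal (δ / 2) + ENNReal.ofReal (δ / 2) := add_le_add hin hout
      _ = ENNReal.ofReal δ := by
        rw [← ENNReal.ofReal_add (by positivity) (by positivity), add_halves]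

/-! ### Linear independence of translates -/

/-- In dimension zero the admissibility integral is a constant times `∫ dξ/ξ`, hence 0 or infinite,
never 1. The uniqueness argument needs a nonzero translation vector. -/
theorem Admissible.dim_ne_zero {d : ℕ} {φ : L2 d} (hφ : Admissible φ) : d ≠ 0 := by
  rintro rfl
  obtain ⟨x, hx⟩ := hφ.exists
  set c : ℝ := ‖((𝓕 φ : L2 0) : EuclideanSpace ℝ (Fin 0) → ℂ) x‖ ^ 2 with hc
  have h1 : ∫⁻ ξ in Set.Ioi (0 : ℝ), ENNReal.ofReal (c * ξ⁻¹) = 1 := by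
    rw [← hx]
    refine lintegral_congr fun ξ => ?_
    rw [Subsingleton.elim (ξ • x) x, div_eq_mul_inv]
  by_cases h0 : c = 0
  · simp [h0] at h1
  · have hint : IntegrableOn (fun ξ : ℝ => c * ξ⁻¹) (Set.Ioi 0) := by
      refine ⟨(measurable_id.inv.const_mul c).aestronglyMeasurable, ?_⟩
      rw [hasFiniteIntegral_iff_ofReal, h1]
      · exact ENNReal.one_lt_top
      · filter_upwards [ae_restrict_mem measurableSet_Ioi] with ξ hξ
        exact mul_nonneg (by positivity) (inv_nonneg.2 (Set.mem_Ioi.1 hξ).le)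
    refine not_integrableOn_Ioi_inv (a := 0) ?_
    have := hint.const_mul c⁻¹
    simp only [← mul_assoc, inv_mul_cancel₀ h0, one_mul] at this
    exact this

theorem volume_inner_eq {d : ℕ} {b : EuclideanSpace ℝ (Fin d)} (hb : b ≠ 0) (c : ℝ) :
    volume {η : EuclideanSpace ℝ (Fin d) | (inner ℝ b η : ℝ) = c} = 0 := by
  rcases Set.eq_empty_or_nonempty {η : EuclideanSpace ℝ (Fin d) | (inner ℝ b η : ℝ) = c} with
    h | ⟨η₀, hη₀⟩
  · rw [h, measure_empty]
  · have e : {η : EuclideanSpace ℝ (Fin d) | (inner ℝ b η : ℝ) = c} =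
        (fun η => η - η₀) ⁻¹' ((innerₗ (EuclideanSpace ℝ (Fin d)) b).ker : Set _) := by
      ext η
      simp only [Set.mem_ofPred_eq, Set.mem_preimage, SetLike.mem_coe, LinearMap.mem_ker,
        innerₗ_apply_apply, inner_sub_right]
      rw [show inner ℝ b η₀ = c from hη₀, sub_eq_zero]
    rw [e, (measurePreserving_sub_right volume η₀).measure_preimage
      (Submodule.closed_of_finiteDimensional _).measurableSet.nullMeasurableSet]
    refine Measure.addHaar_submodule _ _ fun htop => hb ?_
    have : b ∈ (innerₗ (EuclideanSpace ℝ (Fin d)) b).ker := by rw [htop]; trivial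
    simpa using this

/-- A level set of a nontrivial character is empty or lies in countably many parallel hyperplanes.
-/
theorem volume_fourierChar_eq {d : ℕ} {b : EuclideanSpace ℝ (Fin d)} (hb : b ≠ 0) (z : ℂ) :
    volume {η : EuclideanSpace ℝ (Fin d) |
      ((Real.fourierChar (-(inner ℝ b η : ℝ)) : Circle) : ℂ) = z} = 0 := by
  rcases Set.eq_empty_or_nonempty {η : EuclideanSpace ℝ (Fin d) |
      ((Real.fourierChar (-(inner ℝ b η : ℝ)) : Circle) : ℂ) = z} with h | ⟨η₀, hη₀⟩
  · rw [h, measure_empty]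
  · refine measure_mono_null (t := ⋃ m : ℤ, {η : EuclideanSpace ℝ (Fin d) |
      (inner ℝ b η : ℝ) = inner ℝ b η₀ - m}) (fun η hη => ?_)
      (measure_iUnion_null fun m => volume_inner_eq hb _)
    have h : Real.fourierChar (-(inner ℝ b η : ℝ)) = Real.fourierChar (-(inner ℝ b η₀ : ℝ)) :=
      Circle.coe_injective (Eq.trans (b := z) hη (Eq.symm hη₀))
    rw [Real.fourierChar_apply', Real.fourierChar_apply', Circle.exp_eq_exp] at h
    obtain ⟨m, hm⟩ := h
    refine Set.mem_iUnion.2 ⟨m, ?_⟩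
    have hpi : (2 * Real.pi) ≠ 0 := by positivity
    have : (2 * Real.pi) * (-(inner ℝ b η : ℝ)) = 2 * Real.pi * (-(inner ℝ b η₀ : ℝ) + m) := by
      rw [hm]; ring
    have := mul_left_cancel₀ hpi this
    simp only [Set.mem_ofPred_eq]
    linarith

/-- Translations have no eigenvectors in `L²`. -/
theorem eq_zero_of_translation_eigenvector {d : ℕ} {b : EuclideanSpace ℝ (Fin d)} (hb : b ≠ 0)
    {z : ℂ} {f : L2 d} (h : atom f (affTrans b) = z • f) : f = 0 := by
  -- On the Fourier side translation is multiplication by a character, which differs from `z` almost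
  -- everywhere, so `𝓕 f` must vanish.
  have hF := congrArg (fun u : L2 d => (𝓕 u : L2 d)) h
  simp only [fourier_atom, FourierTransform.fourier_smul] at hF
  have h0 : (𝓕 f : L2 d) = 0 := by
    apply Lp.ext
    have hnull : ∀ᵐ η : EuclideanSpace ℝ (Fin d),
        ((Real.fourierChar (-(inner ℝ b η : ℝ)) : Circle) : ℂ) ≠ z :=
      measure_eq_zero_iff_ae_notMem.1 (volume_fourierChar_eq hb z)
    filter_upwards [hnull, coeFn_modulate (((affTrans b).1 : ℝ) • (affTrans b).2)
      (atom (𝓕 f : L2 d) (dilInv (affTrans b))), coeFn_atom (𝓕 f : L2 d) (dilInv (affTrans b)),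
      Lp.coeFn_smul z (𝓕 f : L2 d), Lp.coeFn_zero ℂ 2 (volume : Measure (EuclideanSpace ℝ (Fin d)))]
      with η h1 h2 h3 h4 h5
    rw [hF, h4, h3, Pi.smul_apply] at h2
    simp only [atomFun, dilInv, affTrans, inv_one, Real.one_rpow, Complex.ofReal_one, one_mul,
      one_smul, sub_zero, Circle.smul_def, smul_eq_mul] at h2
    rw [h5]
    by_contra hne
    exact h1 (mul_right_cancel₀ hne h2).symm
  have hn := Lp.norm_fourier_eq f
  rw [h0, norm_zero] at hn
  exact norm_eq_zero.1 hn.symm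

/-- Over `ℂ` a linear factor `X - z` splits off; `τ - z` is injective, so the degree can be lowered.
Injectivity of `p ↦ p(τ) v` is the independence of the orbit of `v`. -/
theorem aeval_apply_ne_zero {V : Type*} [AddCommGroup V] [Module ℂ V] {τ : Module.End ℂ V}
    (hτ : ∀ (z : ℂ) (v : V), τ v = z • v → v = 0) {v : V} (hv : v ≠ 0) (n : ℕ) :
    ∀ p : Polynomial ℂ, p.natDegree = n → p ≠ 0 → Polynomial.aeval τ p v ≠ 0 := by
  induction n with
  | zero =>
    intro p hp hp0 h
    rw [Polynomial.eq_C_of_natDegree_eq_zero hp, Polynomial.aeval_C, Module.algebraMap_end_apply,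
      smul_eq_zero] at h
    rcases h with h | h
    · rw [Polynomial.eq_C_of_natDegree_eq_zero hp, h, Polynomial.C_0] at hp0
      exact hp0 rfl
    · exact hv h
  | succ n ih =>
    intro p hp hp0 h
    obtain ⟨z, hz⟩ := IsAlgClosed.exists_root p (by
      rw [Polynomial.degree_eq_natDegree hp0, hp]; exact_mod_cast n.succ_ne_zero)
    obtain ⟨q, rfl⟩ := Polynomial.dvd_iff_isRoot.2 hz
    have hq0 : q ≠ 0 := right_ne_zero_of_mul hp0
    have hqn : q.natDegree = n := by
      rw [Polynomial.natDegree_mul (Polynomial.X_sub_C_ne_zero z) hq0,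
        Polynomial.natDegree_X_sub_C] at hp
      omega
    refine ih q hqn hq0 (hτ z _ ?_)
    rw [map_mul, Module.End.mul_apply, map_sub, Polynomial.aeval_X, Polynomial.aeval_C,
      LinearMap.sub_apply, Module.algebraMap_end_apply, sub_eq_zero] at h
    exact h

theorem linearIndependent_pow_apply {V : Type*} [AddCommGroup V] [Module ℂ V]
    {τ : Module.End ℂ V} (hτ : ∀ (z : ℂ) (v : V), τ v = z • v → v = 0) {v : V} (hv : v ≠ 0) :
    LinearIndependent ℂ (fun n : ℕ => (τ ^ n) v) := by
  have h := (Polynomial.basisMonomials ℂ).linearIndependent.map'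
    ((LinearMap.applyₗ v).comp (Polynomial.aeval τ).toLinearMap) (by
      rw [LinearMap.ker_eq_bot']
      intro p hp
      by_contra hp0
      exact aeval_apply_ne_zero hτ hv _ p rfl hp0 hp)
  have e : (fun n : ℕ => (τ ^ n) v) = ((LinearMap.applyₗ v).comp
      (Polynomial.aeval τ).toLinearMap) ∘ (Polynomial.basisMonomials ℂ) := by
    ext n
    simp
  rw [e]
  exact h

theorem affMul_affTrans {d : ℕ} (b c : EuclideanSpace ℝ (Fin d)) :
    affMul (affTrans b) (affTrans c) = affTrans (b + c) := by
  ext1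
  · ext1; simp [affMul, affTrans]
  · simp [affMul, affTrans]

theorem affMul_affTrans_zero {d : ℕ} (y : AffineGp d) :
    affMul (affTrans (0 : EuclideanSpace ℝ (Fin d))) y = y := by
  ext1
  · ext1; simp [affMul, affTrans]
  · simp [affMul, affTrans]

theorem affRep_affTrans_pow {d : ℕ} (b : EuclideanSpace ℝ (Fin d)) (f : L2 d) (n : ℕ) :
    ((affRep (affTrans b)).toLinearMap ^ (n + 1)) f =
      atom f (affTrans (((n + 1 : ℕ) : ℝ) • b)) := by
  induction n with
  | zero => simp; rfl
  | succ n ih =>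
    rw [pow_succ', Module.End.mul_apply, ih]
    change atom (atom f _) _ = _
    rw [atom_atom, affMul_affTrans]
    congr 2
    push_cast
    module

/-! ### Uniqueness: no transform lives on a set with small tails -/

/-- The left translate of a set by the translation `(1, b)`. -/
def transSet {d : ℕ} (b : EuclideanSpace ℝ (Fin d)) (A : Set (AffineGp d)) : Set (AffineGp d) :=
  affMul (affTrans (-b)) ⁻¹' A

theorem measurableSet_transSet {d : ℕ} (b : EuclideanSpace ℝ (Fin d)) {A : Set (AffineGp d)}
    (hA : MeasurableSet A) : MeasurableSet (transSet b A) :=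
  (affLeft (affTrans (-b))).continuous.measurable hA

theorem waveletTransform_translate {d : ℕ} (φ f : L2 d) (b : EuclideanSpace ℝ (Fin d))
    (g : AffineGp d) : waveletTransform φ (atom f (affTrans b)) g =
      waveletTransform φ f (affMul (affTrans (-b)) g) := by
  have h : affMul (affTrans b) (affMul (affTrans (-b)) g) = g := by
    have : affTrans (-b) = affInv (affTrans b) := by
      ext1
      · ext1; simp [affInv, affTrans]
      · simp [affInv, affTrans]
    rw [this, affMul_affInv_cancel_left]
  rw [← inner_atom_affMul φ f (affTrans b), h]

theorem setLIntegral_transSet {d : ℕ} (φ f : L2 d) (b : EuclideanSpace ℝ (Fin d))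
    (A : Set (AffineGp d)) :
    ∫⁻ g in transSet b A, ‖waveletTransform φ f g‖ₑ ^ 2 ∂haarAffine d =
      ∫⁻ g in A, ‖waveletTransform φ (atom f (affTrans (-b))) g‖ₑ ^ 2 ∂haarAffine d := by
  rw [← (measurePreserving_affMul (affTrans (-b))).setLIntegral_comp_preimage_emb
    (affLeft (affTrans (-b))).measurableEmbedding
    (fun g => ‖waveletTransform φ (atom f (affTrans (-b))) g‖ₑ ^ 2) A]
  refine lintegral_congr fun g => ?_
  rw [inner_atom_affMul]

theorem HasSmallTails.setLIntegral_le {d : ℕ} {φ : L2 d} {E : Set (AffineGp d)}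
    (hE : MeasurableSet E) (h : HasSmallTails φ (E.indicator fun _ => (1 : ℝ))) {δ : ℝ}
    (hδ : 0 < δ) : ∃ K : Set (AffineGp d), IsCompact K ∧ ∀ f : L2 d,
      ∫⁻ g in E ∩ Kᶜ, ‖waveletTransform φ f g‖ₑ ^ 2 ∂haarAffine d ≤
        ENNReal.ofReal δ * ENNReal.ofReal (‖f‖ ^ 2) := by
  obtain ⟨K, hK, hf⟩ := h δ hδ
  refine ⟨K, hK, fun f => le_trans (le_of_eq ?_) (hf f)⟩
  rw [← Measure.restrict_restrict hE, ← lintegral_indicator hE]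
  refine lintegral_congr fun g => ?_
  by_cases hg : g ∈ E <;> simp [hg]

theorem setLIntegral_waveletTransform_le {d : ℕ} (φ f : L2 d) (A : Set (AffineGp d)) :
    ∫⁻ g in A, ‖waveletTransform φ f g‖ₑ ^ 2 ∂haarAffine d ≤
      haarAffine d A * ENNReal.ofReal (‖φ‖ ^ 2) * ENNReal.ofReal (‖f‖ ^ 2) := by
  calc ∫⁻ g in A, ‖waveletTransform φ f g‖ₑ ^ 2 ∂haarAffine d
      ≤ ∫⁻ _ in A, ENNReal.ofReal (‖φ‖ ^ 2) * ENNReal.ofReal (‖f‖ ^ 2) ∂haarAffine d := by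
        refine lintegral_mono fun g => ?_
        rw [← ENNReal.ofReal_mul (by positivity), ← mul_pow, ← ofReal_norm,
          ← ENNReal.ofReal_pow (norm_nonneg _)]
        exact ENNReal.ofReal_le_ofReal
          (pow_le_pow_left₀ (norm_nonneg _) (norm_waveletTransform_le φ f g) 2)
    _ = _ := by rw [setLIntegral_const]; ring

/-- Continuity of translation in measure: the translations preserve the measure and depend
continuously on `b` in the compact-open topology. -/
theorem tendsto_haarAffine_transSet_diff {d : ℕ} {A : Set (AffineGp d)} (hA : MeasurableSet A)
    (hfin : haarAffine d A ≠ ∞) :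
    Tendsto (fun b => haarAffine d (transSet b A \ A)) (𝓝 0) (𝓝 0) := by
  have hcont : Continuous fun p : EuclideanSpace ℝ (Fin d) × AffineGp d =>
      affMul (affTrans (-p.1)) p.2 := by
    refine continuous_affMul.comp (Continuous.prodMk ?_ continuous_snd)
    exact Continuous.prodMk continuous_const continuous_fst.neg
  set Φ : C(EuclideanSpace ℝ (Fin d), C(AffineGp d, AffineGp d)) :=
    ContinuousMap.curry ⟨_, hcont⟩ with hΦ
  have hΦa : ∀ b, (Φ b : AffineGp d → AffineGp d) = affMul (affTrans (-b)) := fun b => rfl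
  have h := tendsto_measure_symmDiff_preimage_nhds_zero (μ := haarAffine d) (ν := haarAffine d)
    (f := Φ) (g := Φ 0) (l := 𝓝 0) (s := A) Φ.continuous.continuousAt
    (Eventually.of_forall fun b => by rw [hΦa]; exact measurePreserving_affMul _)
    (by rw [hΦa]; exact measurePreserving_affMul _) hA.nullMeasurableSet hfin
  refine tendsto_of_tendsto_of_tendsto_of_le_of_le tendsto_const_nhds h (fun _ => zero_le)
    fun b => measure_mono ?_
  have h0 : (Φ 0 : AffineGp d → AffineGp d) ⁻¹' A = A := by
    ext g
    rw [hΦa, neg_zero, Set.mem_preimage, affMul_affTrans_zero]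
  rw [h0, hΦa]
  exact le_sup_left

/-- The energy which a small translation of `E` captures outside of `E` is uniformly small. -/
theorem HasSmallTails.eventually_setLIntegral_transSet_diff_le {d : ℕ} {φ : L2 d}
    {E : Set (AffineGp d)} (hE : MeasurableSet E)
    (h : HasSmallTails φ (E.indicator fun _ => (1 : ℝ))) {δ : ℝ} (hδ : 0 < δ) :
    ∀ᶠ b in 𝓝 (0 : EuclideanSpace ℝ (Fin d)), ∀ f : L2 d,
      ∫⁻ g in transSet b E \ E, ‖waveletTransform φ f g‖ₑ ^ 2 ∂haarAffine d ≤
        ENNReal.ofReal δ * ENNReal.ofReal (‖f‖ ^ 2) := by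
  obtain ⟨K, hK, hKf⟩ := h.setLIntegral_le hE (half_pos hδ)
  have hA : MeasurableSet (E ∩ K) := hE.inter hK.measurableSet
  have hlim := (tendsto_haarAffine_transSet_diff hA
    ((measure_mono Set.inter_subset_right).trans_lt hK.measure_lt_top).ne)
  have hlim2 : Tendsto (fun b => haarAffine d (transSet b (E ∩ K) \ (E ∩ K)) *
      ENNReal.ofReal (‖φ‖ ^ 2)) (𝓝 0) (𝓝 0) := by
    have := ENNReal.Tendsto.mul_const hlim (b := ENNReal.ofReal (‖φ‖ ^ 2))
      (Or.inr ENNReal.ofReal_ne_top)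
    rwa [zero_mul] at this
  filter_upwards [hlim2.eventually (gt_mem_nhds (ENNReal.ofReal_pos.2 (half_pos hδ)))] with b hb f
  -- The moved tail `E ∩ Kᶜ` stays small by unitarity, uniformly in `f`. The part `E ∩ K` has finite
  -- measure, so its shift adds little measure, on which `|W_φ f|² ≤ ‖φ‖² ‖f‖²`.
  have hsub : transSet b E \ E ⊆ transSet b (E ∩ Kᶜ) ∪ (transSet b (E ∩ K) \ (E ∩ K)) := by
    rintro g ⟨hg, hgE⟩
    by_cases hgK : affMul (affTrans (-b)) g ∈ K
    · exact Or.inr ⟨⟨hg, hgK⟩, fun hg' => hgE hg'.1⟩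
    · exact Or.inl ⟨hg, hgK⟩
  calc _ ≤ ∫⁻ g in transSet b (E ∩ Kᶜ) ∪ (transSet b (E ∩ K) \ (E ∩ K)),
        ‖waveletTransform φ f g‖ₑ ^ 2 ∂haarAffine d := lintegral_mono_set hsub
    _ ≤ _ := lintegral_union_le _ _ _
    _ ≤ ENNReal.ofReal (δ / 2) * ENNReal.ofReal (‖f‖ ^ 2) +
        ENNReal.ofReal (δ / 2) * ENNReal.ofReal (‖f‖ ^ 2) := by
      refine add_le_add ?_ ?_
      · rw [setLIntegral_transSet, ← norm_atom f (affTrans (-b))]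
        exact hKf _
      · refine (setLIntegral_waveletTransform_le φ f _).trans ?_
        gcongr
    _ = _ := by
      rw [← add_mul, ← ENNReal.ofReal_add (by positivity) (by positivity), add_halves]

/-- Bessel's inequality for the atom at `g` bounds `∑ |W_φ e_i(g)|²` by `‖φ‖²`; integrate over `K`.
-/
theorem card_le_of_orthonormal {d N : ℕ} {φ : L2 d} {K : Set (AffineGp d)}
    {e : Fin N → L2 d} (he : Orthonormal ℂ e) {c : ℝ≥0∞}
    (h : ∀ i, c ≤ ∫⁻ g in K, ‖waveletTransform φ (e i) g‖ₑ ^ 2 ∂haarAffine d) :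
    N * c ≤ haarAffine d K * ENNReal.ofReal (‖φ‖ ^ 2) := by
  calc (N : ℝ≥0∞) * c = ∑ _i : Fin N, c := by simp
    _ ≤ ∑ i : Fin N, ∫⁻ g in K, ‖waveletTransform φ (e i) g‖ₑ ^ 2 ∂haarAffine d :=
      Finset.sum_le_sum fun i _ => h i
    _ = ∫⁻ g in K, ∑ i : Fin N, ‖waveletTransform φ (e i) g‖ₑ ^ 2 ∂haarAffine d :=
      (lintegral_finsetSum _ fun i _ =>
        (measurable_waveletTransform φ (e i)).enorm.pow_const 2).symm
    _ ≤ ∫⁻ _ in K, ENNReal.ofReal (‖φ‖ ^ 2) ∂haarAffine d := by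
      refine lintegral_mono fun g => ?_
      have hb := he.sum_inner_products_le (atom φ g) (s := Finset.univ)
      rw [norm_atom] at hb
      refine le_trans (le_of_eq ?_) (ENNReal.ofReal_le_ofReal hb)
      rw [ENNReal.ofReal_sum_of_nonneg fun i _ => by positivity]
      refine Finset.sum_congr rfl fun i _ => ?_
      rw [ENNReal.ofReal_pow (norm_nonneg _), ofReal_norm, waveletTransform, ← inner_conj_symm,
        RCLike.enorm_conj]
    _ = _ := by rw [setLIntegral_const, mul_comm]

theorem ae_zero_of_mem_span {d : ℕ} {φ : L2 d} {E : Set (AffineGp d)} {S : Set (L2 d)}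
    (hS : ∀ f ∈ S, ∀ᵐ g ∂haarAffine d, g ∉ E → waveletTransform φ f g = 0) {f : L2 d}
    (hf : f ∈ Submodule.span ℂ S) :
    ∀ᵐ g ∂haarAffine d, g ∉ E → waveletTransform φ f g = 0 := by
  induction hf using Submodule.span_induction with
  | mem f hf => exact hS f hf
  | zero => exact Eventually.of_forall fun g _ => inner_zero_right _
  | add f h _ _ h1 h2 =>
    filter_upwards [h1, h2] with g h1 h2 hg
    rw [waveletTransform_add, h1 hg, h2 hg, add_zero]
  | smul c f _ h1 =>
    filter_upwards [h1] with g h1 hg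
    rw [waveletTransform_smul, h1 hg, mul_zero]

/-- A function whose wavelet transform lives on a set with small tails vanishes. -/
theorem HasSmallTails.eq_zero {d : ℕ} {φ : L2 d} (hφ : Admissible φ) {E : Set (AffineGp d)}
    (hE : MeasurableSet E) (h : HasSmallTails φ (E.indicator fun _ => (1 : ℝ))) {f : L2 d}
    (hf : ∀ᵐ g ∂haarAffine d, g ∉ E → waveletTransform φ f g = 0) : f = 0 := by
  by_contra hf0
  obtain ⟨K, hK, hKf⟩ := h.setLIntegral_le hE (δ := 1 / 4) (by norm_num)
  obtain ⟨v, hv⟩ : ∃ v : EuclideanSpace ℝ (Fin d), v ≠ 0 := by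
    have : Nonempty (Fin d) := ⟨⟨0, Nat.pos_of_ne_zero hφ.dim_ne_zero⟩⟩
    exact exists_ne 0
  have hfin : haarAffine d K * ENNReal.ofReal (‖φ‖ ^ 2) * 2 ≠ ∞ :=
    ENNReal.mul_ne_top (ENNReal.mul_ne_top hK.measure_lt_top.ne ENNReal.ofReal_ne_top)
      ENNReal.ofNat_ne_top
  -- Chosen to contradict `N / 2 ≤ λ(K) ‖φ‖²` at the end.
  obtain ⟨N, hN⟩ := ENNReal.exists_nat_gt hfin
  have hN0 : 0 < N := by
    rcases Nat.eq_zero_or_pos N with h0 | h0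
    · simp [h0] at hN
    · exact h0
  have hNr : (0 : ℝ) < N := by exact_mod_cast hN0
  -- The bound `1 / (4N)` for each of the `N` translates leaves `1 / 4` for their union, and the
  -- tail of `E` costs another `1 / 4`. It must hold for all `u`, since it is applied to arbitrary
  -- vectors of the span.
  obtain ⟨t, ht, ht0⟩ : ∃ t : ℝ, (∀ k : Fin N, ∀ u : L2 d,
      ∫⁻ g in transSet (((k + 1 : ℕ) : ℝ) • t • v) E \ E, ‖waveletTransform φ u g‖ₑ ^ 2
        ∂haarAffine d ≤ ENNReal.ofReal (1 / (4 * N)) * ENNReal.ofReal (‖u‖ ^ 2)) ∧ t ≠ 0 := by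
    have hev : ∀ᶠ t in 𝓝 (0 : ℝ), ∀ k : Fin N, ∀ u : L2 d,
        ∫⁻ g in transSet (((k + 1 : ℕ) : ℝ) • t • v) E \ E, ‖waveletTransform φ u g‖ₑ ^ 2
        ∂haarAffine d ≤ ENNReal.ofReal (1 / (4 * N)) * ENNReal.ofReal (‖u‖ ^ 2) := by
      rw [eventually_all]
      intro k
      have hc : Tendsto (fun t : ℝ => ((k + 1 : ℕ) : ℝ) • t • v) (𝓝 0) (𝓝 0) := by
        have : Continuous (fun t : ℝ => ((k + 1 : ℕ) : ℝ) • t • v) := by fun_prop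
        simpa using this.tendsto 0
      exact hc.eventually (h.eventually_setLIntegral_transSet_diff_le hE (by positivity))
    exact ((hev.filter_mono nhdsWithin_le_nhds).and
      (self_mem_nhdsWithin : {(0 : ℝ)}ᶜ ∈ 𝓝[≠] (0 : ℝ))).exists
  set b := t • v with hb
  have hb0 : b ≠ 0 := smul_ne_zero ht0 hv
  set E' : Set (AffineGp d) := ⋃ k : Fin N, transSet (((k + 1 : ℕ) : ℝ) • b) E with hE'
  set u : Fin N → L2 d := fun k => atom f (affTrans (((k + 1 : ℕ) : ℝ) • b)) with hu
  have hli : LinearIndependent ℂ u := by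
    have h1 := (linearIndependent_pow_apply (τ := (affRep (affTrans b)).toLinearMap)
      (fun z w hw => eq_zero_of_translation_eigenvector hb0 hw) hf0).comp
      (fun k : Fin N => (k : ℕ) + 1) (fun i j hij => by ext; simpa using hij)
    have e : u = (fun n : ℕ => ((affRep (affTrans b)).toLinearMap ^ n) f) ∘
        (fun k : Fin N => (k : ℕ) + 1) := by
      ext1 k
      exact (affRep_affTrans_pow b f k).symm
    rw [e]
    exact h1
  have hspan : ∀ w ∈ Submodule.span ℂ (Set.range u),
      ∀ᵐ g ∂haarAffine d, g ∉ E' → waveletTransform φ w g = 0 := by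
    refine fun w hw => ae_zero_of_mem_span ?_ hw
    rintro _ ⟨k, rfl⟩
    filter_upwards [(measurePreserving_affMul
      (affTrans (-(((k + 1 : ℕ) : ℝ) • b)))).quasiMeasurePreserving.ae hf] with g hg hgE
    rw [hu, waveletTransform_translate]
    exact hg fun hmem => hgE (Set.mem_iUnion.2 ⟨k, hmem⟩)
  have hlow : ∀ w ∈ Submodule.span ℂ (Set.range u), ‖w‖ = 1 →
      ENNReal.ofReal (1 / 2) ≤
        ∫⁻ g in K, ‖waveletTransform φ w g‖ₑ ^ 2 ∂haarAffine d := by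
    intro w hw hw1
    have htot : (1 : ℝ≥0∞) = ∫⁻ g in E', ‖waveletTransform φ w g‖ₑ ^ 2 ∂haarAffine d := by
      have hmE' : MeasurableSet E' := MeasurableSet.iUnion fun k => measurableSet_transSet _ hE
      have h1 := lintegral_waveletTransform_sq hφ w
      rw [hw1, one_pow, ENNReal.ofReal_one] at h1
      rw [← h1, ← lintegral_indicator hmE']
      refine lintegral_congr_ae ?_
      filter_upwards [hspan w hw] with g hg
      by_cases hgE : g ∈ E'
      · simp [hgE]
      · simp [hgE, hg hgE]
    have hsub : E' ⊆ K ∪ ((E ∩ Kᶜ) ∪ ⋃ k : Fin N, transSet (((k + 1 : ℕ) : ℝ) • b) E \ E) := by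
      intro g hg
      obtain ⟨k, hk⟩ := Set.mem_iUnion.1 hg
      by_cases hgK : g ∈ K
      · exact Or.inl hgK
      · by_cases hgE : g ∈ E
        · exact Or.inr (Or.inl ⟨hgE, hgK⟩)
        · exact Or.inr (Or.inr (Set.mem_iUnion.2 ⟨k, hk, hgE⟩))
    have hup : (1 : ℝ≥0∞) ≤ (∫⁻ g in K, ‖waveletTransform φ w g‖ₑ ^ 2 ∂haarAffine d) +
        ENNReal.ofReal (1 / 2) := by
      rw [htot]
      refine (lintegral_mono_set hsub).trans ((lintegral_union_le _ _ _).trans ?_)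
      gcongr
      refine (lintegral_union_le _ _ _).trans ?_
      have e2 : ENNReal.ofReal (1 / 2) =
          ENNReal.ofReal (1 / 4) + N * ENNReal.ofReal (1 / (4 * N)) := by
        rw [← ENNReal.ofReal_natCast N, ← ENNReal.ofReal_mul hNr.le,
          ← ENNReal.ofReal_add (by norm_num) (by positivity)]
        congr 1
        field_simp
        norm_num
      rw [e2]
      refine add_le_add ?_ ?_
      · simpa [hw1] using hKf w
      · refine (lintegral_iUnion_le _ _).trans ?_
        rw [tsum_fintype]
        refine (Finset.sum_le_sum fun k _ => ht k w).trans ?_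
        simp [hw1]
    have e3 : (1 : ℝ≥0∞) = ENNReal.ofReal (1 / 2) + ENNReal.ofReal (1 / 2) := by
      rw [← ENNReal.ofReal_add (by norm_num) (by norm_num)]; norm_num
    rw [e3] at hup
    exact (ENNReal.add_le_add_iff_right ENNReal.ofReal_ne_top).1 hup
  have hfr : Module.finrank ℂ (Submodule.span ℂ (Set.range u)) = N := by
    rw [finrank_span_eq_card hli, Fintype.card_fin]
  have : FiniteDimensional ℂ (Submodule.span ℂ (Set.range u)) :=
    FiniteDimensional.span_of_finite ℂ (Set.finite_range u)
  set B := (stdOrthonormalBasis ℂ (Submodule.span ℂ (Set.range u))).reindex (finCongr hfr)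
  have hBo : Orthonormal ℂ (fun i => (B i : L2 d)) :=
    B.orthonormal.comp_linearIsometry (Submodule.subtypeₗᵢ _)
  have hcard := card_le_of_orthonormal (φ := φ) (K := K) hBo (c := ENNReal.ofReal (1 / 2))
    (fun i => hlow _ (B i).2 (hBo.1 i))
  refine absurd hN (not_lt.2 ?_)
  calc (N : ℝ≥0∞) = N * ENNReal.ofReal (1 / 2) * 2 := by
        rw [mul_assoc, ← ENNReal.ofReal_ofNat 2, ← ENNReal.ofReal_mul (by norm_num)]
        norm_num
    _ ≤ _ := by gcongr

/-! ### Weak compactness and the lower bound -/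

/-- Sequential Banach-Alaoglu in the dual, transported by the Riesz isomorphism; conjugation
switches the argument of the inner product. -/
theorem exists_weakly_convergent_subseq {H : Type*} [NormedAddCommGroup H] [InnerProductSpace ℂ H]
    [CompleteSpace H] [TopologicalSpace.SeparableSpace H] {f : ℕ → H} {r : ℝ}
    (hf : ∀ n, ‖f n‖ ≤ r) :
    ∃ (f₀ : H) (ψ : ℕ → ℕ), StrictMono ψ ∧
      ∀ x, Tendsto (fun n => (inner ℂ x (f (ψ n)) : ℂ)) atTop (𝓝 (inner ℂ x f₀)) := by
  obtain ⟨T, -, ψ, hψ, hT⟩ := WeakDual.isSeqCompact_closedBall ℂ H 0 r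
    (x := fun n => StrongDual.toWeakDual (InnerProductSpace.toDual ℂ H (f n))) (fun n => by
      change InnerProductSpace.toDual ℂ H (f n) ∈ Metric.closedBall 0 r
      rw [mem_closedBall_zero_iff, LinearIsometryEquiv.norm_map]
      exact hf n)
  refine ⟨(InnerProductSpace.toDual ℂ H).symm (WeakDual.toStrongDual T), ψ, hψ, fun x => ?_⟩
  have h := ((WeakDual.eval_continuous x).tendsto T).comp hT
  have h2 := (Complex.continuous_conj.tendsto _).comp h
  rw [← inner_conj_symm, InnerProductSpace.toDual_symm_apply]
  refine h2.congr fun n => ?_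
  exact inner_conj_symm x (f (ψ n))

theorem HasSmallTails.mono {d : ℕ} {φ : L2 d} {σ τ : AffineGp d → ℝ} (h : HasSmallTails φ σ)
    (hle : ∀ g, τ g ≤ σ g) : HasSmallTails φ τ := by
  intro δ hδ
  obtain ⟨K, hK, hf⟩ := h δ hδ
  refine ⟨K, hK, fun f => (lintegral_mono fun g => ?_).trans (hf f)⟩
  gcongr
  exact hle g

theorem HasSmallTails.exists_lower_bound {d : ℕ} {φ : L2 d} (hφ : Admissible φ)
    {σ : AffineGp d → ℝ} (hm : Measurable σ) (hσ : ∀ g, σ g ∈ Set.Icc (0 : ℝ) 1)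
    (h : HasSmallTails φ σ) :
    ∃ c : ℝ, 0 < c ∧ ∀ f : L2 d,
      c * ‖f‖ ^ 2 ≤ ∫ g, (1 - σ g) * ‖waveletTransform φ f g‖ ^ 2 ∂haarAffine d := by
  have hm1 : Measurable fun g => 1 - σ g := measurable_const.sub hm
  have hσ1 : ∀ g, 1 - σ g ∈ Set.Icc (0 : ℝ) 1 := fun g =>
    ⟨sub_nonneg.2 (hσ g).2, sub_le_self _ (hσ g).1⟩
  by_contra! hcon
  have hex : ∀ n : ℕ, ∃ f : L2 d, ‖f‖ = 1 ∧
      ∫⁻ g, ENNReal.ofReal (1 - σ g) * ‖waveletTransform φ f g‖ₑ ^ 2 ∂haarAffine d ≤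
        ENNReal.ofReal (1 / ((n : ℝ) + 1)) := by
    intro n
    obtain ⟨f, hf⟩ := hcon (1 / ((n : ℝ) + 1)) (by positivity)
    have hf0 : f ≠ 0 := by
      rintro rfl
      simp [waveletTransform] at hf
    have hnf : ‖f‖ ≠ 0 := norm_ne_zero_iff.2 hf0
    have hnorm : ‖((‖f‖⁻¹ : ℝ) : ℂ) • f‖ = 1 := by
      rw [norm_smul, Complex.norm_real, norm_inv, norm_norm, inv_mul_cancel₀ hnf]
    refine ⟨((‖f‖⁻¹ : ℝ) : ℂ) • f, hnorm, ?_⟩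
    rw [← ofReal_integral_mul_waveletTransform_sq hφ hm1 hσ1]
    refine ENNReal.ofReal_le_ofReal ?_
    have e : ∀ g, (1 - σ g) * ‖waveletTransform φ (((‖f‖⁻¹ : ℝ) : ℂ) • f) g‖ ^ 2 =
        (‖f‖⁻¹) ^ 2 * ((1 - σ g) * ‖waveletTransform φ f g‖ ^ 2) := fun g => by
      rw [waveletTransform_smul, norm_mul, Complex.norm_real, norm_inv, norm_norm]
      ring
    simp_rw [e]
    rw [integral_const_mul, inv_pow, inv_mul_le_iff₀ (by positivity)]
    linarith
  choose f hf1 hfQ using hex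
  have : Fact ((2 : ℝ≥0∞) ≠ ∞) := ⟨ENNReal.ofNat_ne_top⟩
  obtain ⟨f₀, ψ, hψ, hlim⟩ := exists_weakly_convergent_subseq (fun n => (hf1 n).le)
  -- Weak convergence tested against the atom at `g` is pointwise convergence of the transforms.
  have hW : ∀ g, Tendsto (fun n => ‖waveletTransform φ (f (ψ n)) g‖ₑ ^ 2) atTop
      (𝓝 (‖waveletTransform φ f₀ g‖ₑ ^ 2)) := fun g =>
    ENNReal.Tendsto.pow ((continuous_enorm.tendsto _).comp (hlim (atom φ g)))
  have hmW : ∀ u : L2 d, Measurable fun g => ‖waveletTransform φ u g‖ₑ ^ 2 := fun u =>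
    (measurable_waveletTransform φ u).enorm.pow_const 2
  have hmQ : ∀ u : L2 d, Measurable fun g =>
      ENNReal.ofReal (1 - σ g) * ‖waveletTransform φ u g‖ₑ ^ 2 := fun u =>
    hm1.ennreal_ofReal.mul (hmW u)
  have hinv : Tendsto (fun n : ℕ => ENNReal.ofReal (1 / ((ψ n : ℝ) + 1))) atTop (𝓝 0) := by
    have h1 := (tendsto_one_div_add_atTop_nhds_zero_nat (𝕜 := ℝ)).comp hψ.tendsto_atTop
    simpa using ENNReal.tendsto_ofReal h1
  have hQlim : Tendsto (fun n => ∫⁻ g, ENNReal.ofReal (1 - σ g) *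
      ‖waveletTransform φ (f (ψ n)) g‖ₑ ^ 2 ∂haarAffine d) atTop (𝓝 0) :=
    tendsto_of_tendsto_of_tendsto_of_le_of_le tendsto_const_nhds hinv (fun _ => zero_le)
      fun n => hfQ (ψ n)
  have hQ0 : ∫⁻ g, ENNReal.ofReal (1 - σ g) * ‖waveletTransform φ f₀ g‖ₑ ^ 2 ∂haarAffine d = 0 := by
    refine le_antisymm ?_ zero_le
    have hfatou := lintegral_liminf_le (μ := haarAffine d) (u := atTop) (f := fun n g =>
      ENNReal.ofReal (1 - σ g) * ‖waveletTransform φ (f (ψ n)) g‖ₑ ^ 2)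
      (fun n => hm1.ennreal_ofReal.mul (hmW _))
    rw [hQlim.liminf_eq] at hfatou
    refine le_trans (le_of_eq (lintegral_congr fun g => ?_)) hfatou
    exact (ENNReal.Tendsto.const_mul (hW g) (Or.inr ENNReal.ofReal_ne_top)).liminf_eq.symm
  have hf₀ : f₀ = 0 := by
    -- By Fatou `(1 - σ) |W_φ f₀|²` vanishes almost everywhere, so the transform lives where `σ =
    -- 1`; this set inherits small tails because its indicator is at most `σ`.
    refine HasSmallTails.eq_zero hφ (E := {g | σ g = 1}) (hm (measurableSet_singleton 1))
      (h.mono fun g => ?_) ?_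
    · by_cases hg : g ∈ {g | σ g = 1}
      · rw [Set.indicator_of_mem hg]
        exact (Eq.symm hg).le
      · rw [Set.indicator_of_notMem hg]
        exact (hσ g).1
    · rw [lintegral_eq_zero_iff (hmQ _)] at hQ0
      filter_upwards [hQ0] with g hg hgE
      rcases mul_eq_zero.1 hg with h0 | h0
      · exact absurd (le_antisymm (hσ g).2 (sub_nonpos.1 (ENNReal.ofReal_eq_zero.1 h0))) hgE
      · simpa using h0
  obtain ⟨K, hK, hKf⟩ := h (1 / 2) (by norm_num)
  -- Dominated convergence with the constant `‖φ‖²`, integrable because `K` has finite measure.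
  have hKlim : Tendsto (fun n => ∫⁻ g in K, ‖waveletTransform φ (f (ψ n)) g‖ₑ ^ 2 ∂haarAffine d)
      atTop (𝓝 0) := by
    have hdom := tendsto_lintegral_of_dominated_convergence (μ := (haarAffine d).restrict K)
      (F := fun n g => ‖waveletTransform φ (f (ψ n)) g‖ₑ ^ 2)
      (f := fun g => ‖waveletTransform φ f₀ g‖ₑ ^ 2) (fun _ => ENNReal.ofReal (‖φ‖ ^ 2))
      (fun n => hmW _) (fun n => Eventually.of_forall fun g => ?_) ?_
      (Eventually.of_forall fun g => hW g)
    · simpa [hf₀, waveletTransform] using hdom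
    · have hb := norm_waveletTransform_le φ (f (ψ n)) g
      rw [hf1, mul_one] at hb
      dsimp only
      rw [← ofReal_norm, ← ENNReal.ofReal_pow (norm_nonneg _)]
      exact ENNReal.ofReal_le_ofReal (pow_le_pow_left₀ (norm_nonneg _) hb 2)
    · rw [setLIntegral_const]
      exact ENNReal.mul_ne_top ENNReal.ofReal_ne_top hK.measure_lt_top.ne
  have hbound : ∀ n, (1 : ℝ≥0∞) ≤
      (∫⁻ g, ENNReal.ofReal (1 - σ g) * ‖waveletTransform φ (f (ψ n)) g‖ₑ ^ 2 ∂haarAffine d) +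
      ((∫⁻ g in K, ‖waveletTransform φ (f (ψ n)) g‖ₑ ^ 2 ∂haarAffine d) +
        ENNReal.ofReal (1 / 2)) := by
    intro n
    have h1 := lintegral_waveletTransform_sq hφ (f (ψ n))
    rw [hf1, one_pow, ENNReal.ofReal_one] at h1
    rw [← h1]
    have hsplit : ∀ g, ‖waveletTransform φ (f (ψ n)) g‖ₑ ^ 2 =
        ENNReal.ofReal (1 - σ g) * ‖waveletTransform φ (f (ψ n)) g‖ₑ ^ 2 +
        ENNReal.ofReal (σ g) * ‖waveletTransform φ (f (ψ n)) g‖ₑ ^ 2 := fun g => by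
      rw [← add_mul, ← ENNReal.ofReal_add (hσ1 g).1 (hσ g).1, sub_add_cancel, ENNReal.ofReal_one,
        one_mul]
    rw [lintegral_congr hsplit, lintegral_add_left (hmQ _),
      ← lintegral_add_compl (fun g => ENNReal.ofReal (σ g) *
        ‖waveletTransform φ (f (ψ n)) g‖ₑ ^ 2) hK.measurableSet]
    gcongr with g
    · exact mul_le_of_le_one_left zero_le (ENNReal.ofReal_le_one.2 (hσ g).2)
    · simpa [hf1] using hKf (f (ψ n))
  -- In the limit only the tail survives, giving the absurd `1 ≤ 1 / 2`.
  have hfinal := ge_of_tendsto' (hQlim.add (hKlim.add_const (ENNReal.ofReal (1 / 2)))) hbound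
  rw [zero_add, zero_add, ENNReal.one_le_ofReal] at hfinal
  norm_num at hfinal

end WaveletUncertainty

end

theorem mainTheorem5 (d : ℕ) (φ : WaveletUncertainty.L2 d)
    (hφ : φ ∈ WaveletUncertainty.classA1 d) :
    (∀ σ : WaveletUncertainty.AffineGp d → ℝ,
      (∀ g, σ g ∈ Set.Icc (0 : ℝ) 1) → WaveletUncertainty.IsThin φ σ →
      ∃ T : WaveletUncertainty.L2 d →L[ℂ] WaveletUncertainty.L2 d,
        WaveletUncertainty.IsToeplitz φ (fun g => 1 - σ g) T ∧
        ∃ c : ℝ, 0 < c ∧ ∀ f : WaveletUncertainty.L2 d,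
          (inner ℂ f (T f) : ℂ) =
            ((∫ g, (1 - σ g) * ‖WaveletUncertainty.waveletTransform φ f g‖ ^ 2
              ∂(WaveletUncertainty.haarAffine d) : ℝ) : ℂ) ∧
          c * ‖f‖ ^ 2 ≤
            ∫ g, (1 - σ g) * ‖WaveletUncertainty.waveletTransform φ f g‖ ^ 2
              ∂(WaveletUncertainty.haarAffine d)) ∧
    (∀ E : Set (WaveletUncertainty.AffineGp d), WaveletUncertainty.IsThinSet φ E →
      ∃ c : ℝ, 0 < c ∧ ∀ f : WaveletUncertainty.L2 d,
        c * ‖f‖ ^ 2 ≤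
          ∫ g in Eᶜ, ‖WaveletUncertainty.waveletTransform φ f g‖ ^ 2
            ∂(WaveletUncertainty.haarAffine d)) := by
  have hadm : WaveletUncertainty.Admissible φ := hφ.2
  refine ⟨fun σ hσ hthin => ?_, fun E hE => ?_⟩
  · have hs : ∀ g, 1 - σ g ∈ Set.Icc (0 : ℝ) 1 := fun g =>
      ⟨sub_nonneg.2 (hσ g).2, sub_le_self _ (hσ g).1⟩
    have hT := WaveletUncertainty.isToeplitz_toeplitz hadm (measurable_const.sub hthin.1) hs
    obtain ⟨c, hc, hcf⟩ := (hthin.hasSmallTails hφ hσ).exists_lower_bound hadm hthin.1 hσ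
    exact ⟨_, hT, c, hc, fun f => ⟨hT.inner_self f, hcf f⟩⟩
  · have hσ : ∀ g, E.indicator (fun _ => (1 : ℝ)) g ∈ Set.Icc (0 : ℝ) 1 := fun g =>
      ⟨Set.indicator_nonneg (fun _ _ => zero_le_one) g,
        Set.indicator_le_self' (fun _ _ => zero_le_one) g⟩
    have hEm : MeasurableSet E := (measurable_indicator_const_iff (1 : ℝ)).1 hE.1
    obtain ⟨c, hc, hcf⟩ :=
      (WaveletUncertainty.IsThin.hasSmallTails hφ hσ hE).exists_lower_bound hadm hE.1 hσ
    refine ⟨c, hc, fun f => (hcf f).trans (le_of_eq ?_)⟩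
    rw [← MeasureTheory.integral_indicator hEm.compl]
    congr 1
    ext g
    by_cases hg : g ∈ E <;> simp [hg]
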